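/- **Setting.** Let $n\ge 2$. Let $X\subset\mathbb R^n$ be a finite set with a weight $w:X\to\mathbb R_{>0}$. Let $r_1,\dots,r_p$ be the distinct values of $\|x\|$ for $x\in X$, let $S_i=\{x\in\mathbb R^n:\|x\|=r_i\}$ (so $S_i=\{0\}$ if $r_i=0$), $X_i=X\cap S_i$, $w(X_i)=\sum_{x\in X_i}w(x)$ and $S=\bigcup_{i=1}^p S_i$; we say that $X$ is supported by the $p$ concentric spheres $S_1,\dots,S_p$. The pair $(X,w)$ is a *Euclidean $t$-design* if $$\sum_{i=1}^p \frac{w(X_i)}{|S_i|}\int_{S_i} f\,d\sigma_i=\sum_{x\in X}w(x)f(x)$$ for every real polynomial $f$ in $n$ variables of degree at most $t$, where $\sigma_i$ is the surface measure on $S_i$, $|S_i|=\sigma_i(S_i)$, and $\frac1{|S_i|}\int_{S_i}f\,d\sigma_i$ means $f(0)$ if $r_i=0$. Let $\mathrm{Pol}_e(\mathbb R^n)$ be the space of real polynomials of degree at most $e$, let $\mathrm{Pol}^*_e(\mathbb R^n)$ be the span of the homogeneous polynomials of degrees $i\le e$ with $i\equiv e \pmod 2$, and let $\mathrm{Pol}_e(S)$,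 $\mathrm{Pol}_e^*(S)$ be the spaces of their restrictions to $S$. * A *tight Euclidean $2e$-design* is a Euclidean $2e$-design $(X,w)$ with $|X|=\dim\mathrm{Pol}_e(S)=\dim \mathrm{Pol}_e(\mathbb R^n)$. * An *antipodal tight Euclidean $(2e+1)$-design* is a Euclidean $(2e+1)$-design $(X,w)$ with $X=-X$, $w(x)=w(-x)$ for all $x\in X$, and $|X^*|=\dim\mathrm{Pol}^*_e(S)=\dim\mathrm{Pol}_e^*(\mathbb R^n)$, where $X^*\subseteq X$ satisfies $X^*\cup(-X^*)=X$ and $X^*\cap(-X^*)\in\{\emptyset,\{0\}\}$. Two weighted sets $(X,w)$, $(X',w')$ in $\mathbb R^n$ are *isomorphic* if there are $g\in O(n)$ and real $\lambda,\mu>0$ with $X'=\{\lambda g(x):x\in X\}$ and $w'(\lambda g(x))=\mu\,w(x)$ for all $x\in X$. **Corollary 3.9.** In each of the following cases there are infinitely many pairwise non-isomorphic designs. 1. For every $n\ge2$ and every $p\in\{2,3,\dots,n+1\}$: tight Euclidean $2$-designs in $\mathbb R^n$ supported by exactly $p$ concentric spheres. 2. Antipodal tight Euclidean $3$-designs in $\mathbb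 R^2$ supported by exactly $2$ concentric spheres (circles). 3. For each $p\in\{3,4\}$: tight Euclidean $4$-designs in $\mathbb R^2$ supported by exactly $p$ concentric spheres (circles). 4. For each $p\in\{3,4\}$: antipodal tight Euclidean $5$-designs in $\mathbb R^2$ supported by exactly $p$ concentric spheres (circles). -/

import Mathlib

open MeasureTheory
open scoped Pointwise

/-- A finite subset `X` of `ℝⁿ` with a weight that is positive on `X`.
The values of `weight` outside `X` play no role. -/
structure WeightedPointSet (n : ℕ) where
  carrier : Finset (EuclideanSpace ℝ (Fin n))
  weight : EuclideanSpace ℝ (Fin n) → ℝ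
  weight_pos : ∀ x ∈ carrier, 0 < weight x

/-- Evaluation of a real polynomial in `n` variables at a point of `ℝⁿ`. -/
noncomputable def polyEval {n : ℕ} (f : MvPolynomial (Fin n) ℝ)
    (x : EuclideanSpace ℝ (Fin n)) : ℝ :=
  MvPolynomial.eval (fun i => x i) f

/-- The normalized surface integral `(1 / |S_r|) ∫_{S_r} g dσ_r` over the sphere `S_r` of radius `r`
about the origin, computed on the unit sphere (with its surface measure) via `u ↦ r u`.
For `r = 0` this is `g 0`, see `sphereMean_zero`. -/
noncomputable def sphereMean {n : ℕ} (r : ℝ) (g : EuclideanSpace ℝ (Fin n) → ℝ) : ℝ :=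
  ⨍ u : Metric.sphere (0 : EuclideanSpace ℝ (Fin n)) 1,
    g (r • (u : EuclideanSpace ℝ (Fin n)))
      ∂((volume : Measure (EuclideanSpace ℝ (Fin n))).toSphere)

theorem sphereMean_zero {n : ℕ} (hn : 1 ≤ n) (g : EuclideanSpace ℝ (Fin n) → ℝ) :
    sphereMean 0 g = g 0 := by
  have : Nonempty (Fin n) := ⟨⟨0, hn⟩⟩
  have : NeZero ((volume : Measure (EuclideanSpace ℝ (Fin n))).toSphere) :=
    ⟨Measure.toSphere_ne_zero _⟩
  simp [sphereMean]

/-- Restriction of polynomials to a subset `S` of `ℝⁿ`, as a linear map. -/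
noncomputable def polyRestrict {n : ℕ} (S : Set (EuclideanSpace ℝ (Fin n))) :
    MvPolynomial (Fin n) ℝ →ₗ[ℝ] (S → ℝ) where
  toFun f x := polyEval f x
  map_add' f g := by
    funext x
    simp [polyEval]
  map_smul' c f := by
    funext x
    simp [polyEval]

/-- `Pol_e(ℝⁿ)`: the polynomials of total degree at most `e`. -/
noncomputable def polSpace (n e : ℕ) : Submodule ℝ (MvPolynomial (Fin n) ℝ) :=
  MvPolynomial.restrictTotalDegree (Fin n) ℝ e

/-- `Pol*_e(ℝⁿ)`: the sum of the spaces of homogeneous polynomials of degree `i`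
over all `i ≤ e` with `i ≡ e` modulo `2`. -/
noncomputable def polStarSpace (n e : ℕ) : Submodule ℝ (MvPolynomial (Fin n) ℝ) :=
  ⨆ i ∈ {i : ℕ | i ≤ e ∧ i ≡ e [MOD 2]}, MvPolynomial.homogeneousSubmodule (Fin n) ℝ i

namespace WeightedPointSet

variable {n : ℕ}

/-- The radii of the concentric spheres that support `X`
(the radius `0`, with sphere `{0}`, is included when `0 ∈ X`). -/
noncomputable def radii (D : WeightedPointSet n) : Finset ℝ :=
  D.carrier.image (fun x => ‖x‖)

/-- The number `p` of concentric spheres that support `X`. -/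
noncomputable def numSpheres (D : WeightedPointSet n) : ℕ :=
  D.radii.card

/-- The union `S` of the concentric spheres that support `X`. -/
def support (D : WeightedPointSet n) : Set (EuclideanSpace ℝ (Fin n)) :=
  {x | ‖x‖ ∈ D.radii}

/-- The total weight of the points of `X` on the sphere of radius `r`. -/
noncomputable def sphereWeight (D : WeightedPointSet n) (r : ℝ) : ℝ :=
  ∑ x ∈ D.carrier with ‖x‖ = r, D.weight x

/-- `(X, w)` is a Euclidean `t`-design in `ℝⁿ`. -/
def IsEuclideanDesign (D : WeightedPointSet n) (t : ℕ) : Prop :=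
  ∀ f : MvPolynomial (Fin n) ℝ, f.totalDegree ≤ t →
    ∑ r ∈ D.radii, D.sphereWeight r * sphereMean r (polyEval f)
      = ∑ x ∈ D.carrier, D.weight x * polyEval f x

/-- `(X, w)` is a tight `2e`-design on the union `S` of its supporting spheres. -/
def IsTightOnSupport (D : WeightedPointSet n) (e : ℕ) : Prop :=
  D.IsEuclideanDesign (2 * e) ∧
    D.carrier.card = Module.finrank ℝ ((polSpace n e).map (polyRestrict D.support))

/-- `(X, w)` is a tight Euclidean `2e`-design. -/
def IsTightEuclidean (D : WeightedPointSet n) (e : ℕ) : Prop :=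
  D.IsTightOnSupport e ∧
    Module.finrank ℝ ((polSpace n e).map (polyRestrict D.support))
      = Module.finrank ℝ (polSpace n e)

/-- `X = -X` and `w(x) = w(-x)` for all `x ∈ X`. -/
def IsAntipodal (D : WeightedPointSet n) : Prop :=
  ∀ x ∈ D.carrier, -x ∈ D.carrier ∧ D.weight (-x) = D.weight x

/-- `H` is an antipodal half of `X`: `H ∪ (-H) = X`, and `H ∩ (-H)` is `{0}` or empty. -/
def IsAntipodalHalf (D : WeightedPointSet n) (H : Finset (EuclideanSpace ℝ (Fin n))) : Prop :=
  (H : Set (EuclideanSpace ℝ (Fin n))) ∪ -(H : Set (EuclideanSpace ℝ (Fin n)))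
      = (D.carrier : Set (EuclideanSpace ℝ (Fin n))) ∧
    (H : Set (EuclideanSpace ℝ (Fin n))) ∩ -(H : Set (EuclideanSpace ℝ (Fin n))) ⊆ {0}

/-- `(X, w)` is an antipodal tight `(2e+1)`-design on the union `S` of its supporting spheres.
All antipodal halves of `X` have the same number of points. -/
def IsAntipodalTightOnSupport (D : WeightedPointSet n) (e : ℕ) : Prop :=
  D.IsEuclideanDesign (2 * e + 1) ∧ D.IsAntipodal ∧
    ∃ H : Finset (EuclideanSpace ℝ (Fin n)), D.IsAntipodalHalf H ∧
      H.card = Module.finrank ℝ ((polStarSpace n e).map (polyRestrict D.support))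

/-- `(X, w)` is an antipodal tight Euclidean `(2e+1)`-design. -/
def IsAntipodalTightEuclidean (D : WeightedPointSet n) (e : ℕ) : Prop :=
  D.IsAntipodalTightOnSupport e ∧
    Module.finrank ℝ ((polStarSpace n e).map (polyRestrict D.support))
      = Module.finrank ℝ (polStarSpace n e)

/-- `(X, w)` and `(X', w')` are isomorphic: an orthogonal transformation `g`, followed by a scaling
by `c > 0`, maps `X` onto `X'`, and carries `w` to `w'` up to a constant factor `m > 0`. -/
def Isomorphic (D D' : WeightedPointSet n) : Prop :=
  ∃ (g : EuclideanSpace ℝ (Fin n) ≃ₗᵢ[ℝ] EuclideanSpace ℝ (Fin n)) (c m : ℝ),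
    0 < c ∧ 0 < m ∧
      (∀ x, x ∈ D.carrier ↔ c • g x ∈ D'.carrier) ∧
      ∀ x ∈ D.carrier, D'.weight (c • g x) = m * D.weight x

end WeightedPointSet

/-- There are infinitely many pairwise non-isomorphic weighted point sets with property `P`. -/
def InfinitelyManyNonisomorphic {n : ℕ} (P : WeightedPointSet n → Prop) : Prop :=
  ∃ D : ℕ → WeightedPointSet n, (∀ k, P (D k)) ∧
    ∀ k l, k ≠ l → ¬ (D k).Isomorphic (D l)

/-! Over the sphere of radius `r` a monomial of degree `d` has mean `r ^ d` times its mean over the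
unit sphere. Hence the spheres drop out of the design equations: each monomial of degree `d ≤ t`
must have weighted sum equal to its unit mean times `∑ w(x) ‖x‖ ^ d`. In the plane, for `t ≤ 5`,
this is a short list of moment identities (`isEuclideanDesign_of_moments`).

Tightness is a count of points once restriction to `S` is injective. An affine polynomial that is
zero on one sphere of positive radius is zero, and so is a plane quadratic that is zero on two such
circles; the counts are then `n + 1` and `6` points, and `2` and `4` for antipodal halves.

For 2-designs, take positive weights with sum one and complete the unit vector `√w` to an orthogonal
matrix. The remaining rows, rescaled, give `n + 1` points with squared radii `1 / w k - 1`, so the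
number of distinct weights is the number of spheres (`exists_tight_two`). The planar designs are
explicit one-parameter families.

Quotients of squared radii form a finite set invariant under isomorphism. A family that realizes
infinitely many quotients therefore has infinitely many isomorphism classes
(`infinitelyManyNonisomorphic_of_normRatios`). -/

/-! ### Means of polynomials over spheres. -/

/-- The homeomorphism of the unit sphere induced by a linear isometry. -/
noncomputable def sphereHomeomorph {n : ℕ}
    (L : EuclideanSpace ℝ (Fin n) ≃ₗᵢ[ℝ] EuclideanSpace ℝ (Fin n)) :
    Metric.sphere (0 : EuclideanSpace ℝ (Fin n)) 1 ≃ₜ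
      Metric.sphere (0 : EuclideanSpace ℝ (Fin n)) 1 :=
  L.toHomeomorph.subtype (fun x => by simp)

theorem coe_sphereHomeomorph {n : ℕ}
    (L : EuclideanSpace ℝ (Fin n) ≃ₗᵢ[ℝ] EuclideanSpace ℝ (Fin n))
    (u : Metric.sphere (0 : EuclideanSpace ℝ (Fin n)) 1) :
    (sphereHomeomorph L u : EuclideanSpace ℝ (Fin n)) = L u := rfl

/-- The surface measure of `s` is proportional to the volume of the cone over `s`, and `L` carries
cones to cones while preserving volume. -/
theorem measurePreserving_sphereHomeomorph {n : ℕ}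
    (L : EuclideanSpace ℝ (Fin n) ≃ₗᵢ[ℝ] EuclideanSpace ℝ (Fin n)) :
    MeasurePreserving (sphereHomeomorph L)
      (volume : Measure (EuclideanSpace ℝ (Fin n))).toSphere
      (volume : Measure (EuclideanSpace ℝ (Fin n))).toSphere := by
  refine ⟨(sphereHomeomorph L).measurable, ?_⟩
  ext s hs
  rw [Measure.map_apply (sphereHomeomorph L).measurable hs, Measure.toSphere_apply' _ hs,
    Measure.toSphere_apply' _ ((sphereHomeomorph L).measurable hs)]
  congr 1
  have : Set.Ioo (0 : ℝ) 1 • ((↑) '' (sphereHomeomorph L ⁻¹' s) : Set (EuclideanSpace ℝ (Fin n)))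
      = L ⁻¹' (Set.Ioo (0 : ℝ) 1 • ((↑) '' s)) := by
    ext x
    simp only [Set.mem_smul, Set.mem_image, Set.mem_preimage]
    constructor
    · rintro ⟨c, hc, _, ⟨u, hu, rfl⟩, rfl⟩
      exact ⟨c, hc, _, ⟨_, hu, rfl⟩, by simp [coe_sphereHomeomorph]⟩
    · rintro ⟨c, hc, _, ⟨u, hu, rfl⟩, h⟩
      refine ⟨c, hc, _, ⟨(sphereHomeomorph L).symm u, by simpa using hu, rfl⟩, ?_⟩
      apply L.injective
      rw [← h, map_smul, ← coe_sphereHomeomorph, Homeomorph.apply_symm_apply]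
  rw [this]
  exact L.measurePreserving.measure_preimage_equiv (f := L.toMeasurableEquiv) _

theorem sphereMean_comp_isometry {n : ℕ}
    (L : EuclideanSpace ℝ (Fin n) ≃ₗᵢ[ℝ] EuclideanSpace ℝ (Fin n)) (r : ℝ)
    (g : EuclideanSpace ℝ (Fin n) → ℝ) :
    sphereMean r (fun x => g (L x)) = sphereMean r g := by
  unfold sphereMean
  rw [average_eq, average_eq]
  congr 1
  rw [← (measurePreserving_sphereHomeomorph L).integral_comp
    (sphereHomeomorph L).measurableEmbedding (fun u => g (r • (u : EuclideanSpace ℝ (Fin n))))]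
  simp [coe_sphereHomeomorph]

theorem sphereMean_integrable {n : ℕ} (r : ℝ) {g : EuclideanSpace ℝ (Fin n) → ℝ}
    (hg : Continuous g) :
    Integrable (fun u : Metric.sphere (0 : EuclideanSpace ℝ (Fin n)) 1 =>
      g (r • (u : EuclideanSpace ℝ (Fin n))))
      (volume : Measure (EuclideanSpace ℝ (Fin n))).toSphere := by
  have hc : Continuous (fun u : Metric.sphere (0 : EuclideanSpace ℝ (Fin n)) 1 =>
      g (r • (u : EuclideanSpace ℝ (Fin n)))) := by fun_prop
  exact hc.integrable_of_hasCompactSupport (HasCompactSupport.of_compactSpace _)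

theorem sphereMean_add {n : ℕ} (r : ℝ) {f g : EuclideanSpace ℝ (Fin n) → ℝ}
    (hf : Continuous f) (hg : Continuous g) :
    sphereMean r (fun x => f x + g x) = sphereMean r f + sphereMean r g := by
  unfold sphereMean
  simp only [average_eq]
  rw [integral_add (sphereMean_integrable r hf) (sphereMean_integrable r hg), smul_add]

theorem sphereMean_const_mul {n : ℕ} (r c : ℝ) (f : EuclideanSpace ℝ (Fin n) → ℝ) :
    sphereMean r (fun x => c * f x) = c * sphereMean r f := by
  unfold sphereMean
  simp only [average_eq]
  rw [integral_const_mul, smul_eq_mul, smul_eq_mul]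
  ring

theorem sphereMean_const {n : ℕ} (hn : 1 ≤ n) (r c : ℝ) :
    sphereMean r (fun _ : EuclideanSpace ℝ (Fin n) => c) = c := by
  have : Nonempty (Fin n) := ⟨⟨0, hn⟩⟩
  have : NeZero ((volume : Measure (EuclideanSpace ℝ (Fin n))).toSphere) :=
    ⟨Measure.toSphere_ne_zero _⟩
  simp [sphereMean]

theorem sphereMean_sum {n : ℕ} {ι : Type*} (s : Finset ι) (r : ℝ)
    {f : ι → EuclideanSpace ℝ (Fin n) → ℝ} (hf : ∀ i, Continuous (f i)) :
    sphereMean r (fun x => ∑ i ∈ s, f i x) = ∑ i ∈ s, sphereMean r (f i) := by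
  unfold sphereMean
  simp only [average_eq]
  rw [integral_finsetSum _ (fun i _ => sphereMean_integrable r (hf i)), Finset.smul_sum]

theorem sphereMean_congr_sphere {n : ℕ} {f g : EuclideanSpace ℝ (Fin n) → ℝ}
    (h : ∀ x, ‖x‖ = 1 → f x = g x) : sphereMean 1 f = sphereMean 1 g := by
  unfold sphereMean
  congr 1
  funext u
  exact h _ (by simp)

theorem polyEval_eq_sum {n : ℕ} (f : MvPolynomial (Fin n) ℝ) (x : EuclideanSpace ℝ (Fin n)) :
    polyEval f x = ∑ s ∈ f.support, f.coeff s * ∏ i, x i ^ s i := by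
  simp [polyEval, MvPolynomial.eval_eq']

theorem sphereMean_monomial_scale {n : ℕ} (s : Fin n →₀ ℕ) (r : ℝ) :
    sphereMean r (fun x : EuclideanSpace ℝ (Fin n) => ∏ i, x i ^ s i)
      = r ^ s.degree * sphereMean 1 (fun x : EuclideanSpace ℝ (Fin n) => ∏ i, x i ^ s i) := by
  rw [← sphereMean_const_mul]
  unfold sphereMean
  congr 1
  funext u
  simp [mul_pow, Finset.prod_mul_distrib, Finset.prod_pow_eq_pow_sum, Finsupp.degree_eq_sum]

/-- To be a Euclidean design may be tested on monomials. -/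
theorem WeightedPointSet.isEuclideanDesign_of_monomials {n : ℕ} (D : WeightedPointSet n) (t : ℕ)
    (h : ∀ s : Fin n →₀ ℕ, s.degree ≤ t →
      sphereMean 1 (fun x : EuclideanSpace ℝ (Fin n) => ∏ i, x i ^ s i) *
        ∑ x ∈ D.carrier, D.weight x * ‖x‖ ^ s.degree
        = ∑ x ∈ D.carrier, D.weight x * ∏ i, x i ^ s i) :
    D.IsEuclideanDesign t := by
  intro f hf
  -- Homogeneity turns the sum over radii into `∑ w(x) ‖x‖ ^ d`, grouped by the norm of `x`.
  have key : ∀ s : Fin n →₀ ℕ, s.degree ≤ t →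
      ∑ r ∈ D.radii, D.sphereWeight r *
        sphereMean r (fun x : EuclideanSpace ℝ (Fin n) => ∏ i, x i ^ s i)
        = ∑ x ∈ D.carrier, D.weight x * ∏ i, x i ^ s i := by
    intro s hs
    rw [← h s hs, Finset.mul_sum,
      ← Finset.sum_fiberwise_of_maps_to (g := fun x => ‖x‖) (t := D.radii)
        (fun x hx => Finset.mem_image_of_mem _ hx)]
    refine Finset.sum_congr rfl fun r _ => ?_
    rw [sphereMean_monomial_scale, sphereWeight, Finset.sum_mul]
    refine Finset.sum_congr rfl fun x hx => ?_
    rw [(Finset.mem_filter.1 hx).2]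
    ring
  have e : polyEval f = fun x => ∑ s ∈ f.support, f.coeff s * ∏ i, x i ^ s i :=
    funext (polyEval_eq_sum f)
  simp only [e]
  have e2 : ∀ r, sphereMean r (fun x : EuclideanSpace ℝ (Fin n) =>
      ∑ s ∈ f.support, f.coeff s * ∏ i, x i ^ s i)
      = ∑ s ∈ f.support, f.coeff s *
        sphereMean r (fun x : EuclideanSpace ℝ (Fin n) => ∏ i, x i ^ s i) := by
    intro r
    rw [sphereMean_sum _ _ (fun s => by fun_prop)]
    exact Finset.sum_congr rfl fun s _ => sphereMean_const_mul _ _ _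
  simp only [e2, Finset.mul_sum]
  rw [Finset.sum_comm, Finset.sum_comm (s := D.carrier)]
  refine Finset.sum_congr rfl fun s hs => ?_
  have := key s ((MvPolynomial.le_totalDegree hs).trans hf)
  calc _ = f.coeff s * ∑ r ∈ D.radii, D.sphereWeight r *
        sphereMean r (fun x : EuclideanSpace ℝ (Fin n) => ∏ i, x i ^ s i) := by
        rw [Finset.mul_sum]; exact Finset.sum_congr rfl fun r _ => by ring
    _ = _ := by
        rw [this, Finset.mul_sum]; exact Finset.sum_congr rfl fun r _ => by ring

/-- The reflection of `ℝⁿ` that negates the `i`-th coordinate. -/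
noncomputable def coordReflection {n : ℕ} (i : Fin n) :
    EuclideanSpace ℝ (Fin n) ≃ₗᵢ[ℝ] EuclideanSpace ℝ (Fin n) :=
  LinearIsometryEquiv.piLpCongrRight 2
    (fun j => if j = i then LinearIsometryEquiv.neg ℝ else LinearIsometryEquiv.refl ℝ ℝ)

theorem coordReflection_apply {n : ℕ} (i j : Fin n) (x : EuclideanSpace ℝ (Fin n)) :
    coordReflection i x j = if j = i then - x j else x j := by
  simp only [coordReflection, LinearIsometryEquiv.piLpCongrRight_apply]
  split_ifs <;> simp

/-- Negating the `i`-th coordinate preserves the mean but changes the sign of the monomial. -/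
theorem sphereMean_monomial_of_odd {n : ℕ} (s : Fin n →₀ ℕ) {i : Fin n} (hi : Odd (s i)) (r : ℝ) :
    sphereMean r (fun x : EuclideanSpace ℝ (Fin n) => ∏ i, x i ^ s i) = 0 := by
  have h := sphereMean_comp_isometry (coordReflection i) r
    (fun x : EuclideanSpace ℝ (Fin n) => ∏ i, x i ^ s i)
  have e : (fun x : EuclideanSpace ℝ (Fin n) => ∏ j, coordReflection i x j ^ s j)
      = fun x => (-1) * ∏ j, x j ^ s j := by
    funext x
    rw [← Finset.mul_prod_erase _ _ (Finset.mem_univ i),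
      ← Finset.mul_prod_erase _ (fun j => x j ^ s j) (Finset.mem_univ i), coordReflection_apply,
      if_pos rfl, hi.neg_pow,
      Finset.prod_congr rfl (fun j hj => by
        rw [coordReflection_apply, if_neg (Finset.ne_of_mem_erase hj)])]
    ring
  rw [e, sphereMean_const_mul] at h
  linarith

/-- Coordinate swaps make the `n` means equal, and on the unit sphere the squares add up to one. -/
theorem sphereMean_sq {n : ℕ} (i : Fin n) :
    sphereMean 1 (fun x : EuclideanSpace ℝ (Fin n) => x i ^ 2) = 1 / n := by
  have hn : 1 ≤ n := Fin.pos i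
  have hj : ∀ j : Fin n, sphereMean 1 (fun x : EuclideanSpace ℝ (Fin n) => x j ^ 2)
      = sphereMean 1 (fun x : EuclideanSpace ℝ (Fin n) => x i ^ 2) := by
    intro j
    rw [← sphereMean_comp_isometry (LinearIsometryEquiv.piLpCongrLeft 2 ℝ ℝ (Equiv.swap i j)) 1
      (fun x : EuclideanSpace ℝ (Fin n) => x i ^ 2)]
    simp [LinearIsometryEquiv.piLpCongrLeft_apply]
  have hs := sphereMean_sum (n := n) Finset.univ 1
    (f := fun i x => x i ^ 2) (fun i => by fun_prop)
  rw [sphereMean_congr_sphere (g := fun _ => 1), sphereMean_const hn] at hs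
  · simp only [hj, Finset.sum_const, Finset.card_univ, Fintype.card_fin, nsmul_eq_mul] at hs
    have : (n : ℝ) ≠ 0 := by positivity
    field_simp
    linarith
  · intro x hx
    have := EuclideanSpace.norm_sq_eq x
    simp [hx] at this
    simp [← this]

/-- The reflection of the plane that maps `(x, y)` to `((x + y) / √2, (x - y) / √2)`. -/
noncomputable def diagonalReflection :
    EuclideanSpace ℝ (Fin 2) ≃ₗᵢ[ℝ] EuclideanSpace ℝ (Fin 2) where
  toLinearEquiv := LinearEquiv.ofInvolutive
    { toFun := fun x => !₂[(x 0 + x 1) / √2, (x 0 - x 1) / √2]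
      map_add' := fun x y => by ext i; fin_cases i <;> simp <;> ring
      map_smul' := fun c x => by ext i; fin_cases i <;> simp <;> ring }
    (fun x => by
      have h : √2 * √2 = (2 : ℝ) := Real.mul_self_sqrt (by norm_num)
      have h0 : √2 ≠ (0 : ℝ) := by positivity
      ext i
      fin_cases i
      · simp; field_simp; linear_combination (- x 0) * h
      · simp; field_simp; linear_combination (- x 1) * h)
  norm_map' := fun x => by
    have h : √2 ^ 2 = (2 : ℝ) := Real.sq_sqrt (by norm_num)
    rw [EuclideanSpace.norm_eq, EuclideanSpace.norm_eq]
    change √(∑ i, ‖(!₂[(x 0 + x 1) / √2, (x 0 - x 1) / √2] : EuclideanSpace ℝ (Fin 2)) i‖ ^ 2) = _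
    simp only [Real.norm_eq_abs, sq_abs, Fin.sum_univ_two]
    simp only [Matrix.cons_val_zero, Matrix.cons_val_one, div_pow, h]
    ring_nf

theorem diagonalReflection_apply_zero (x : EuclideanSpace ℝ (Fin 2)) :
    diagonalReflection x 0 = (x 0 + x 1) / √2 := rfl

/-- Write `P` for the mean of a pure fourth power and `M` for the mixed mean. Invariance under the
diagonal reflection gives `4 P = 2 P + 6 M`, and the square of `x² + y² = 1` gives `2 P + 2 M = 1`.
-/
theorem sphereMean_plane_quartic :
    sphereMean 1 (fun x : EuclideanSpace ℝ (Fin 2) => x 0 ^ 4) = 3 / 8 ∧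
    sphereMean 1 (fun x : EuclideanSpace ℝ (Fin 2) => x 1 ^ 4) = 3 / 8 ∧
    sphereMean 1 (fun x : EuclideanSpace ℝ (Fin 2) => x 0 ^ 2 * x 1 ^ 2) = 1 / 8 := by
  have h : √2 ^ 2 = (2 : ℝ) := Real.sq_sqrt (by norm_num)
  have hs : sphereMean 1 (fun x : EuclideanSpace ℝ (Fin 2) => x 1 ^ 4)
      = sphereMean 1 (fun x : EuclideanSpace ℝ (Fin 2) => x 0 ^ 4) := by
    rw [← sphereMean_comp_isometry (LinearIsometryEquiv.piLpCongrLeft 2 ℝ ℝ (Equiv.swap 0 1)) 1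
      (fun x : EuclideanSpace ℝ (Fin 2) => x 0 ^ 4)]
    simp [LinearIsometryEquiv.piLpCongrLeft_apply]
  have hodd1 : sphereMean 1 (fun x : EuclideanSpace ℝ (Fin 2) => x 0 ^ 3 * x 1) = 0 := by
    simpa [Fin.prod_univ_two] using sphereMean_monomial_of_odd (n := 2)
      (Finsupp.equivFunOnFinite.symm ![3, 1]) (i := 1) (by simp) 1
  have hodd2 : sphereMean 1 (fun x : EuclideanSpace ℝ (Fin 2) => x 0 * x 1 ^ 3) = 0 := by
    simpa [Fin.prod_univ_two] using sphereMean_monomial_of_odd (n := 2)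
      (Finsupp.equivFunOnFinite.symm ![1, 3]) (i := 0) (by simp) 1
  have hd := sphereMean_comp_isometry diagonalReflection 1
      (fun x : EuclideanSpace ℝ (Fin 2) => x 0 ^ 4)
  have e : (fun x : EuclideanSpace ℝ (Fin 2) => diagonalReflection x 0 ^ 4)
      = fun x => (1 / 4) * (x 0 ^ 4 + (x 1 ^ 4 + (6 * (x 0 ^ 2 * x 1 ^ 2) +
        (4 * (x 0 ^ 3 * x 1) + 4 * (x 0 * x 1 ^ 3))))) := by
    funext x
    have h4 : √2 ^ 4 = (4 : ℝ) := by rw [show (4 : ℕ) = 2 * 2 from rfl, pow_mul, h]; norm_num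
    rw [diagonalReflection_apply_zero, div_pow, h4]
    ring
  rw [e, sphereMean_const_mul, sphereMean_add _ (by fun_prop) (by fun_prop),
    sphereMean_add _ (by fun_prop) (by fun_prop), sphereMean_add _ (by fun_prop) (by fun_prop),
    sphereMean_add _ (by fun_prop) (by fun_prop), sphereMean_const_mul, sphereMean_const_mul,
    sphereMean_const_mul, hodd1, hodd2, hs] at hd
  have h1 := sphereMean_const (n := 2) (by norm_num) 1 1
  rw [sphereMean_congr_sphere (g := fun x => x 0 ^ 4 + (x 1 ^ 4 + 2 * (x 0 ^ 2 * x 1 ^ 2))),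
    sphereMean_add _ (by fun_prop) (by fun_prop), sphereMean_add _ (by fun_prop) (by fun_prop),
    sphereMean_const_mul, hs] at h1
  · rw [hs]
    refine ⟨?_, ?_, ?_⟩ <;> linarith
  · intro x hx
    have := EuclideanSpace.norm_sq_eq x
    simp [hx, Fin.sum_univ_two] at this
    linear_combination (1 + (x 0 ^ 2 + x 1 ^ 2)) * this

theorem euclideanPlane_norm_sq (x : EuclideanSpace ℝ (Fin 2)) : ‖x‖ ^ 2 = x 0 ^ 2 + x 1 ^ 2 := by
  simp [EuclideanSpace.norm_sq_eq, Fin.sum_univ_two]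

/-! ### Moment criteria for designs. -/

namespace WeightedPointSet

/-- Criterion for a Euclidean 2-design. -/
theorem isEuclideanDesign_two {n : ℕ} (hn : 1 ≤ n) (D : WeightedPointSet n) (c : ℝ)
    (h1 : ∀ i, ∑ x ∈ D.carrier, D.weight x * x i = 0)
    (h2 : ∀ i j, ∑ x ∈ D.carrier, D.weight x * (x i * x j) = if i = j then c else 0) :
    D.IsEuclideanDesign 2 := by
  have hnorm : ∑ x ∈ D.carrier, D.weight x * ‖x‖ ^ 2 = n * c := by
    simp only [EuclideanSpace.norm_sq_eq, Real.norm_eq_abs, sq_abs, Finset.mul_sum]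
    rw [Finset.sum_comm, Finset.sum_congr rfl (fun i _ =>
      (Finset.sum_congr rfl (fun x _ => by rw [sq])).trans (h2 i i))]
    simp
  have split : ∀ (s : Fin n →₀ ℕ) (k : ℕ), s.degree = k + 1 →
      ∃ i s', s = Finsupp.single i 1 + s' ∧ s'.degree = k := by
    intro s k hs
    have : s ≠ 0 := by rintro rfl; simp at hs
    obtain ⟨i, hi⟩ := Finsupp.ne_iff.1 this
    have hle : Finsupp.single i 1 ≤ s := by
      simpa [Finsupp.single_le_iff, Nat.one_le_iff_ne_zero] using hi
    refine ⟨i, s - Finsupp.single i 1, (add_tsub_cancel_of_le hle).symm, ?_⟩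
    have := congrArg Finsupp.degree (add_tsub_cancel_of_le hle)
    rw [map_add, hs, Finsupp.degree_single] at this
    omega
  have prod1 : ∀ (i : Fin n) (s : Fin n →₀ ℕ) (x : EuclideanSpace ℝ (Fin n)),
      ∏ j, x j ^ (Finsupp.single i 1 + s : Fin n →₀ ℕ) j = x i * ∏ j, x j ^ s j := by
    intro i s x
    simp only [Finsupp.add_apply, pow_add, Finset.prod_mul_distrib]
    congr 1
    rw [Finset.prod_eq_single i (fun j _ hj => by simp [hj.symm]) (by simp)]
    simp
  refine D.isEuclideanDesign_of_monomials 2 fun s hs => ?_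
  obtain h | h | h : s.degree = 0 ∨ s.degree = 1 ∨ s.degree = 2 := by omega
  · obtain rfl := (Finsupp.degree_eq_zero_iff s).1 h
    simp [sphereMean_const hn]
  · obtain ⟨i, s', rfl, h'⟩ := split s 0 h
    obtain rfl := (Finsupp.degree_eq_zero_iff s').1 h'
    rw [sphereMean_monomial_of_odd (i := i) _ (by simp)]
    simp only [prod1]
    simpa using (h1 i).symm
  · obtain ⟨i, s', rfl, h'⟩ := split s 1 h
    obtain ⟨j, s'', rfl, h''⟩ := split s' 0 h'
    obtain rfl := (Finsupp.degree_eq_zero_iff s'').1 h''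
    have e := h2 i j
    by_cases hij : i = j
    · subst hij
      rw [h, hnorm]
      simp only [prod1]
      simp only [Finsupp.coe_zero, Pi.zero_apply, pow_zero, Finset.prod_const_one, mul_one,
        ← sq, sphereMean_sq]
      have : (n : ℝ) ≠ 0 := by positivity
      simpa [this, sq] using e.symm
    · rw [sphereMean_monomial_of_odd (i := i) _ (by simp [Ne.symm hij])]
      simp only [prod1]
      simpa [hij] using e.symm

/-- The moment `∑ w(x) x₀ᵃ x₁ᵇ` of a planar weighted point set. -/
noncomputable def moment (D : WeightedPointSet 2) (a b : ℕ) : ℝ :=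
  ∑ x ∈ D.carrier, D.weight x * (x 0 ^ a * x 1 ^ b)

/-- A monomial with an odd exponent has mean zero. The others of degree at most five are constant,
`x i ^ 2` with mean `1 / 2`, or quartic with means `3 / 8` and `1 / 8`; the ratio of the last two is
the factor `3` in `h4`. -/
theorem isEuclideanDesign_of_moments (D : WeightedPointSet 2) (t : ℕ) (ht : t ≤ 5)
    (hodd : ∀ a b, Odd (a + b) → a + b ≤ t → D.moment a b = 0)
    (h2 : 2 ≤ t → D.moment 1 1 = 0 ∧ D.moment 2 0 = D.moment 0 2)
    (h4 : 4 ≤ t → D.moment 3 1 = 0 ∧ D.moment 1 3 = 0 ∧ D.moment 4 0 = 3 * D.moment 2 2 ∧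
      D.moment 0 4 = 3 * D.moment 2 2) : D.IsEuclideanDesign t := by
  refine D.isEuclideanDesign_of_monomials t fun s hs => ?_
  have hprod : ∀ x : EuclideanSpace ℝ (Fin 2), ∏ i, x i ^ s i = x 0 ^ s 0 * x 1 ^ s 1 := fun x => by
    rw [Fin.prod_univ_two]
  have hdeg : s.degree = s 0 + s 1 := by rw [Finsupp.degree_eq_sum, Fin.sum_univ_two]
  have hmom : ∑ x ∈ D.carrier, D.weight x * ∏ i, x i ^ s i = D.moment (s 0) (s 1) := by
    simp only [hprod, moment]
  rw [hmom]
  rw [hdeg] at hs ⊢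
  by_cases h0 : Odd (s 0)
  · rw [sphereMean_monomial_of_odd s h0, zero_mul]
    by_cases h1 : Odd (s 1)
    · obtain h | h : s 0 + s 1 = 2 ∨ s 0 + s 1 = 4 := by
        obtain ⟨a, ha⟩ := h0
        obtain ⟨b, hb⟩ := h1
        omega
      · have e0 : s 0 = 1 := by obtain ⟨a, ha⟩ := h0; obtain ⟨b, hb⟩ := h1; omega
        have e1 : s 1 = 1 := by omega
        rw [e0, e1, (h2 (by omega)).1]
      · obtain e0 | e0 : s 0 = 1 ∨ s 0 = 3 := by
          obtain ⟨a, ha⟩ := h0; obtain ⟨b, hb⟩ := h1; omega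
        · rw [e0, show s 1 = 3 by omega, (h4 (by omega)).2.1]
        · rw [e0, show s 1 = 1 by omega, (h4 (by omega)).1]
    · exact (hodd _ _ (h0.add_even (Nat.not_odd_iff_even.1 h1)) hs).symm
  · by_cases h1 : Odd (s 1)
    · rw [sphereMean_monomial_of_odd s h1, zero_mul]
      exact (hodd _ _ ((Nat.not_odd_iff_even.1 h0).add_odd h1) hs).symm
    · have hn2 : ∑ x ∈ D.carrier, D.weight x * ‖x‖ ^ 2 = D.moment 2 0 + D.moment 0 2 := by
        rw [moment, moment, ← Finset.sum_add_distrib]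
        exact Finset.sum_congr rfl fun x _ => by rw [euclideanPlane_norm_sq]; ring
      have hn4 : ∑ x ∈ D.carrier, D.weight x * ‖x‖ ^ 4
          = D.moment 4 0 + 2 * D.moment 2 2 + D.moment 0 4 := by
        rw [moment, moment, moment, Finset.mul_sum, ← Finset.sum_add_distrib,
          ← Finset.sum_add_distrib]
        refine Finset.sum_congr rfl fun x _ => ?_
        rw [show ‖x‖ ^ 4 = (‖x‖ ^ 2) ^ 2 by ring, euclideanPlane_norm_sq]
        ring
      simp only [hprod]
      rw [Nat.not_odd_iff_even] at h0 h1
      obtain ⟨a, ha⟩ := h0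
      obtain ⟨b, hb⟩ := h1
      have : a + b ≤ 2 := by omega
      obtain ⟨rfl, rfl⟩ | ⟨rfl, rfl⟩ | ⟨rfl, rfl⟩ | ⟨rfl, rfl⟩ | ⟨rfl, rfl⟩ | ⟨rfl, rfl⟩ :
        (a = 0 ∧ b = 0) ∨ (a = 1 ∧ b = 0) ∨ (a = 0 ∧ b = 1) ∨ (a = 2 ∧ b = 0) ∨
          (a = 1 ∧ b = 1) ∨ (a = 0 ∧ b = 2) := by omega
      all_goals norm_num only at ha hb
      all_goals rw [ha, hb]
      all_goals norm_num only [pow_zero, mul_one, one_mul]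
      · simp [sphereMean_const, moment]
      · rw [sphereMean_sq, hn2, ← (h2 (by omega)).2]; norm_num; ring
      · rw [sphereMean_sq, hn2, (h2 (by omega)).2]; norm_num; ring
      · rw [sphereMean_plane_quartic.1, hn4, (h4 (by omega)).2.2.1, (h4 (by omega)).2.2.2]; ring
      · rw [sphereMean_plane_quartic.2.2, hn4, (h4 (by omega)).2.2.1, (h4 (by omega)).2.2.2]; ring
      · rw [sphereMean_plane_quartic.2.1, hn4, (h4 (by omega)).2.2.1, (h4 (by omega)).2.2.2]; ring

theorem IsAntipodal.moment_eq_zero {D : WeightedPointSet 2} (hD : D.IsAntipodal) {a b : ℕ}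
    (hab : Odd (a + b)) : D.moment a b = 0 := by
  have h : D.moment a b = -D.moment a b := by
    unfold moment
    rw [← Finset.sum_neg_distrib]
    refine Finset.sum_nbij' (fun x => -x) (fun x => -x) (fun x hx => (hD x hx).1)
      (fun x hx => (hD x hx).1) (fun x _ => neg_neg x) (fun x _ => neg_neg x) fun x hx => ?_
    have e : (-x 0) ^ a * (-x 1) ^ b = -(x 0 ^ a * x 1 ^ b) := by
      rw [neg_pow (x 0), neg_pow (x 1), mul_mul_mul_comm, ← pow_add, hab.neg_one_pow]
      ring
    rw [(hD x hx).2, PiLp.neg_apply, PiLp.neg_apply, e]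
    ring
  linarith

end WeightedPointSet

/-! ### Dimensions of polynomial spaces and of their restrictions. -/

theorem finrank_map_polyRestrict {n : ℕ} (V : Submodule ℝ (MvPolynomial (Fin n) ℝ))
    (S : Set (EuclideanSpace ℝ (Fin n)))
    (h : ∀ f ∈ V, (∀ x ∈ S, polyEval f x = 0) → f = 0) :
    Module.finrank ℝ (V.map (polyRestrict S)) = Module.finrank ℝ V := by
  rw [← LinearMap.range_domRestrict]
  refine LinearMap.finrank_range_of_inj ?_
  rw [← LinearMap.ker_eq_bot, LinearMap.ker_eq_bot']
  rintro ⟨f, hf⟩ h0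
  refine Subtype.ext (h f hf fun x hx => ?_)
  exact congrFun h0 ⟨x, hx⟩

theorem finrank_restrictSupport {n : ℕ} (T : Finset (Fin n →₀ ℕ)) :
    Module.finrank ℝ (MvPolynomial.restrictSupport ℝ (T : Set (Fin n →₀ ℕ))) = T.card := by
  rw [Module.finrank_eq_nat_card_basis
    (MvPolynomial.basisRestrictSupport ℝ (T : Set (Fin n →₀ ℕ)))]
  simp

theorem polSpace_eq_restrictSupport (n e : ℕ) :
    polSpace n e = MvPolynomial.restrictSupport ℝ {s : Fin n →₀ ℕ | s.degree ≤ e} := rfl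

theorem polStarSpace_eq_restrictSupport (n e : ℕ) :
    polStarSpace n e = MvPolynomial.restrictSupport ℝ
      {s : Fin n →₀ ℕ | s.degree ≤ e ∧ s.degree ≡ e [MOD 2]} := by
  apply le_antisymm
  · refine iSup₂_le fun i hi f hf => ?_
    rw [MvPolynomial.mem_restrictSupport_iff]
    intro s hs
    have : s.degree = i := by
      have := (MvPolynomial.mem_homogeneousSubmodule i f).1 hf (MvPolynomial.mem_support_iff.1 hs)
      rw [Finsupp.degree_eq_weight_one]; exact this
    simpa [this] using hi
  · rw [MvPolynomial.restrictSupport_eq_span, Submodule.span_le]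
    rintro _ ⟨s, hs, rfl⟩
    refine Submodule.mem_iSup_of_mem s.degree (Submodule.mem_iSup_of_mem hs ?_)
    exact MvPolynomial.isHomogeneous_monomial _ rfl

theorem polStarSpace_le_polSpace (n e : ℕ) : polStarSpace n e ≤ polSpace n e := by
  rw [polStarSpace_eq_restrictSupport, polSpace_eq_restrictSupport]
  exact MvPolynomial.restrictSupport_mono _ fun s hs => hs.1

/-- Exponents of monomials in two variables. -/
noncomputable def planeExponent (p : ℕ × ℕ) : Fin 2 →₀ ℕ :=
  Finsupp.equivFunOnFinite.symm ![p.1, p.2]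

theorem planeExponent_injective : Function.Injective planeExponent := by
  rintro ⟨a, b⟩ ⟨c, d⟩ h
  have h0 := DFunLike.congr_fun h 0
  have h1 := DFunLike.congr_fun h 1
  simp [planeExponent] at h0 h1
  simp [h0, h1]

theorem planeExponent_self (s : Fin 2 →₀ ℕ) : planeExponent (s 0, s 1) = s := by
  ext i; fin_cases i <;> simp [planeExponent]

/-- Exponents of bounded degree lie in a finite box, so that dimensions in two variables can be
counted by `decide`. -/
theorem setOf_degree_eq_image (Q : ℕ → Prop) [DecidablePred Q] (N : ℕ) (hQ : ∀ k, Q k → k ≤ N) :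
    {s : Fin 2 →₀ ℕ | Q s.degree} =
      ((((Finset.range (N + 1) ×ˢ Finset.range (N + 1)).filter
        (fun p => Q (p.1 + p.2))).image planeExponent : Finset (Fin 2 →₀ ℕ)) :
          Set (Fin 2 →₀ ℕ)) := by
  ext s
  simp only [Set.mem_ofPred_eq, Finset.coe_image, Set.mem_image, Finset.mem_coe, Finset.mem_filter,
    Finset.mem_product, Finset.mem_range]
  constructor
  · intro h
    have hd : s.degree = s 0 + s 1 := by rw [Finsupp.degree_eq_sum, Fin.sum_univ_two]
    have := hQ _ h
    exact ⟨(s 0, s 1), ⟨by constructor <;> simp <;> omega, hd ▸ h⟩, planeExponent_self s⟩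
  · rintro ⟨⟨a, b⟩, ⟨-, h⟩, rfl⟩
    simpa [Finsupp.degree_eq_sum, Fin.sum_univ_two, planeExponent] using h

theorem finrank_polSpace_two_two : Module.finrank ℝ (polSpace 2 2) = 6 := by
  rw [polSpace_eq_restrictSupport, setOf_degree_eq_image (fun k => k ≤ 2) 2 (fun _ h => h),
    finrank_restrictSupport, Finset.card_image_of_injective _ planeExponent_injective]
  decide

theorem finrank_polStarSpace_two_one : Module.finrank ℝ (polStarSpace 2 1) = 2 := by
  rw [polStarSpace_eq_restrictSupport,
    setOf_degree_eq_image (fun k => k ≤ 1 ∧ k ≡ 1 [MOD 2]) 1 (fun _ h => h.1),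
    finrank_restrictSupport, Finset.card_image_of_injective _ planeExponent_injective]
  decide

theorem finrank_polStarSpace_two_two : Module.finrank ℝ (polStarSpace 2 2) = 4 := by
  rw [polStarSpace_eq_restrictSupport,
    setOf_degree_eq_image (fun k => k ≤ 2 ∧ k ≡ 2 [MOD 2]) 2 (fun _ h => h.1),
    finrank_restrictSupport, Finset.card_image_of_injective _ planeExponent_injective]
  decide

theorem polyEval_eq_sum_of_mem {n : ℕ} {T : Finset (Fin n →₀ ℕ)} {f : MvPolynomial (Fin n) ℝ}
    (hf : f ∈ MvPolynomial.restrictSupport ℝ (T : Set (Fin n →₀ ℕ)))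
    (x : EuclideanSpace ℝ (Fin n)) :
    polyEval f x = ∑ s ∈ T, f.coeff s * ∏ i, x i ^ s i := by
  rw [polyEval_eq_sum]
  refine Finset.sum_subset (by exact_mod_cast (MvPolynomial.mem_restrictSupport_iff ℝ).1 hf) ?_
  intro s _ hs
  rw [MvPolynomial.notMem_support_iff.1 hs, zero_mul]

theorem eq_zero_of_coeff_eq_zero {n : ℕ} {T : Finset (Fin n →₀ ℕ)} {f : MvPolynomial (Fin n) ℝ}
    (hf : f ∈ MvPolynomial.restrictSupport ℝ (T : Set (Fin n →₀ ℕ)))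
    (h : ∀ s ∈ T, f.coeff s = 0) : f = 0 := by
  ext s
  by_cases hs : s ∈ T
  · simp [h s hs]
  · have : s ∉ f.support := fun h' => hs (by
      exact_mod_cast (MvPolynomial.mem_restrictSupport_iff ℝ).1 hf h')
    simpa using MvPolynomial.notMem_support_iff.1 this

/-- The exponents of degree at most one. -/
theorem setOf_degree_le_one (n : ℕ) :
    {s : Fin n →₀ ℕ | s.degree ≤ 1} =
      ((insert 0 (Finset.univ.image fun i => Finsupp.single i 1) : Finset (Fin n →₀ ℕ)) :
        Set (Fin n →₀ ℕ)) := by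
  ext s
  simp only [Set.mem_ofPred_eq, Finset.coe_insert, Finset.coe_image, Finset.coe_univ,
    Set.image_univ, Set.mem_insert_iff, Set.mem_range]
  constructor
  · intro h
    by_cases h0 : s = 0
    · exact Or.inl h0
    · obtain ⟨i, hi⟩ := Finsupp.ne_iff.1 h0
      have hle : Finsupp.single i 1 ≤ s := by
        simpa [Finsupp.single_le_iff, Nat.one_le_iff_ne_zero] using hi
      have e := add_tsub_cancel_of_le hle
      have := congrArg Finsupp.degree e
      rw [map_add, Finsupp.degree_single] at this
      have h' : (s - Finsupp.single i 1).degree = 0 := by omega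
      rw [(Finsupp.degree_eq_zero_iff _).1 h', add_zero] at e
      exact Or.inr ⟨i, e⟩
  · rintro (rfl | ⟨i, rfl⟩) <;> simp

theorem zero_notMem_image_single (n : ℕ) :
    (0 : Fin n →₀ ℕ) ∉ Finset.univ.image (fun i : Fin n => Finsupp.single i 1) := by
  simp [Finsupp.single_eq_zero]

theorem finrank_polSpace_one (n : ℕ) : Module.finrank ℝ (polSpace n 1) = n + 1 := by
  rw [polSpace_eq_restrictSupport, setOf_degree_le_one, finrank_restrictSupport,
    Finset.card_insert_of_notMem (zero_notMem_image_single n),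
    Finset.card_image_of_injective _ (Finsupp.single_left_injective one_ne_zero)]
  simp

/-- An affine polynomial that vanishes on a sphere of positive radius is zero. -/
theorem eq_zero_of_mem_polSpace_one {n : ℕ} (hn : 1 ≤ n) {f : MvPolynomial (Fin n) ℝ}
    (hf : f ∈ polSpace n 1) {r : ℝ} (hr : 0 < r)
    (h : ∀ x : EuclideanSpace ℝ (Fin n), ‖x‖ = r → polyEval f x = 0) : f = 0 := by
  rw [polSpace_eq_restrictSupport, setOf_degree_le_one] at hf
  -- Evaluation at the points `± r` on the coordinate axes already determines all coefficients.
  have key : ∀ (i : Fin n) (t : ℝ), |t| = r →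
      f.coeff 0 + t * f.coeff (Finsupp.single i 1) = 0 := by
    intro i t ht
    have := h (EuclideanSpace.single i t) (by simpa using ht)
    rw [polyEval_eq_sum_of_mem hf, Finset.sum_insert (zero_notMem_image_single n),
      Finset.sum_image (by
        intro a _ b _ hab; exact Finsupp.single_left_injective one_ne_zero hab)] at this
    have e : ∀ k : Fin n, ∏ j, (EuclideanSpace.single i t) j ^ (Finsupp.single k 1 : Fin n →₀ ℕ) j
        = if k = i then t else 0 := by
      intro k
      rw [Finset.prod_eq_single k (fun j _ hj => by simp [hj.symm]) (by simp)]
      simp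
    simp only [e] at this
    simp at this
    linarith
  have k2 : ∀ i : Fin n, f.coeff 0 = 0 ∧ f.coeff (Finsupp.single i 1) = 0 := by
    intro i
    have h1 := key i r (abs_of_pos hr)
    have h2 := key i (-r) (by rw [abs_neg, abs_of_pos hr])
    refine ⟨by linarith, ?_⟩
    have : r * f.coeff (Finsupp.single i 1) = 0 := by linarith
    exact (mul_eq_zero.1 this).resolve_left hr.ne'
  refine eq_zero_of_coeff_eq_zero hf fun s hs => ?_
  rcases Finset.mem_insert.1 hs with rfl | hs
  · exact (k2 ⟨0, hn⟩).1
  · obtain ⟨i, -, rfl⟩ := Finset.mem_image.1 hs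
    exact (k2 i).2

/-- A quadratic polynomial that vanishes on two concentric circles of positive radii is zero. -/
theorem eq_zero_of_mem_polSpace_two {f : MvPolynomial (Fin 2) ℝ} (hf : f ∈ polSpace 2 2)
    {r s : ℝ} (hr : 0 < r) (hs : 0 < s) (hrs : r ≠ s)
    (h : ∀ x : EuclideanSpace ℝ (Fin 2), ‖x‖ = r ∨ ‖x‖ = s → polyEval f x = 0) : f = 0 := by
  have hset : ((Finset.range (2 + 1) ×ˢ Finset.range (2 + 1)).filter
      (fun p : ℕ × ℕ => p.1 + p.2 ≤ 2)) = {(0, 0), (1, 0), (0, 1), (2, 0), (1, 1), (0, 2)} := by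
    decide
  rw [polSpace_eq_restrictSupport, setOf_degree_eq_image (fun k => k ≤ 2) 2 (fun _ h => h),
    hset] at hf
  have ev : ∀ a b : ℝ, polyEval f !₂[a, b] = f.coeff (planeExponent (0, 0)) +
      f.coeff (planeExponent (1, 0)) * a + f.coeff (planeExponent (0, 1)) * b +
      f.coeff (planeExponent (2, 0)) * a ^ 2 + f.coeff (planeExponent (1, 1)) * (a * b) +
      f.coeff (planeExponent (0, 2)) * b ^ 2 := by
    intro a b
    have hp : ∀ p q : ℕ, ∏ i, (!₂[a, b] : EuclideanSpace ℝ (Fin 2)) i ^ planeExponent (p, q) i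
        = a ^ p * b ^ q := by
      intro p q
      simp [Fin.prod_univ_two, planeExponent]
    rw [polyEval_eq_sum_of_mem hf,
      Finset.sum_image (fun a _ b _ hab => planeExponent_injective hab)]
    rw [Finset.sum_insert (by decide), Finset.sum_insert (by decide),
      Finset.sum_insert (by decide), Finset.sum_insert (by decide), Finset.sum_insert (by decide),
      Finset.sum_singleton, hp, hp, hp, hp, hp, hp]
    ring
  have circ : ∀ t : ℝ, 0 < t → (∀ x : EuclideanSpace ℝ (Fin 2), ‖x‖ = t → polyEval f x = 0) →
      f.coeff (planeExponent (1, 0)) = 0 ∧ f.coeff (planeExponent (0, 1)) = 0 ∧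
      f.coeff (planeExponent (1, 1)) = 0 ∧
      f.coeff (planeExponent (0, 0)) + f.coeff (planeExponent (2, 0)) * t ^ 2 = 0 ∧
      f.coeff (planeExponent (0, 0)) + f.coeff (planeExponent (0, 2)) * t ^ 2 = 0 := by
    intro t ht hz
    have hz' : ∀ a b : ℝ, a ^ 2 + b ^ 2 = t ^ 2 → polyEval f !₂[a, b] = 0 := by
      intro a b hab
      refine hz _ ?_
      rw [← abs_of_pos ht, ← abs_norm, ← sq_eq_sq_iff_abs_eq_abs, euclideanPlane_norm_sq, ← hab]
      simp
    have e1 := hz' t 0 (by ring)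
    have e2 := hz' (-t) 0 (by ring)
    have e3 := hz' 0 t (by ring)
    have e4 := hz' 0 (-t) (by ring)
    -- A rational point off the axes: subtracting the axis equations with weights `9 / 25` and `16 /
    -- 25` isolates the coefficient of the mixed term.
    have e5 := hz' (3 / 5 * t) (4 / 5 * t) (by ring)
    rw [ev] at e1 e2 e3 e4 e5
    have c10 : f.coeff (planeExponent (1, 0)) = 0 := by
      have : t * f.coeff (planeExponent (1, 0)) = 0 := by linarith
      exact (mul_eq_zero.1 this).resolve_left ht.ne'
    have c01 : f.coeff (planeExponent (0, 1)) = 0 := by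
      have : t * f.coeff (planeExponent (0, 1)) = 0 := by linarith
      exact (mul_eq_zero.1 this).resolve_left ht.ne'
    rw [c10] at e1 e5
    rw [c01] at e3 e5
    refine ⟨c10, c01, ?_, by linarith, by linarith⟩
    have : t ^ 2 * f.coeff (planeExponent (1, 1)) = 0 := by linarith
    exact (mul_eq_zero.1 this).resolve_left (by positivity)
  obtain ⟨c10, c01, c11, er, er'⟩ := circ r hr fun x hx => h x (Or.inl hx)
  obtain ⟨-, -, -, es, es'⟩ := circ s hs fun x hx => h x (Or.inr hx)
  -- One circle leaves only multiples of `x² + y² - r²`; the second radius excludes these.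
  have hne : r ^ 2 - s ^ 2 ≠ 0 := by
    rw [sub_ne_zero, Ne, sq_eq_sq₀ hr.le hs.le]
    exact hrs
  have c20 : f.coeff (planeExponent (2, 0)) = 0 := by
    have : (r ^ 2 - s ^ 2) * f.coeff (planeExponent (2, 0)) = 0 := by linarith
    exact (mul_eq_zero.1 this).resolve_left hne
  have c02 : f.coeff (planeExponent (0, 2)) = 0 := by
    have : (r ^ 2 - s ^ 2) * f.coeff (planeExponent (0, 2)) = 0 := by linarith
    exact (mul_eq_zero.1 this).resolve_left hne
  have c00 : f.coeff (planeExponent (0, 0)) = 0 := by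
    rw [c20] at er; linarith
  refine eq_zero_of_coeff_eq_zero hf fun u hu => ?_
  simp only [Finset.image_insert, Finset.image_singleton, Finset.mem_insert,
    Finset.mem_singleton] at hu
  rcases hu with rfl | rfl | rfl | rfl | rfl | rfl <;> assumption

/-! ### Weighted sets built from families of points. -/

namespace WeightedPointSet

/-- The weighted point set given by a finite family of points with positive weights. -/
noncomputable def ofFamily {n : ℕ} {ι : Type*} [Fintype ι] [DecidableEq ι]
    (x : ι → EuclideanSpace ℝ (Fin n)) (w : ι → ℝ) (hw : ∀ i, 0 < w i) : WeightedPointSet n where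
  carrier := Finset.univ.image x
  -- Summing over the fibre makes `sum_ofFamily` hold without injectivity of `x`.
  weight := fun y => ∑ i with x i = y, w i
  weight_pos := by
    intro y hy
    obtain ⟨i, -, rfl⟩ := Finset.mem_image.1 hy
    exact Finset.sum_pos (fun j _ => hw j) ⟨i, by simp⟩

section

variable {n : ℕ} {ι : Type*} [Fintype ι] [DecidableEq ι]
  {x : ι → EuclideanSpace ℝ (Fin n)} {w : ι → ℝ} (hw : ∀ i, 0 < w i)

theorem mem_carrier_ofFamily (i : ι) : x i ∈ (ofFamily x w hw).carrier :=
  Finset.mem_image_of_mem _ (Finset.mem_univ i)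

theorem sum_ofFamily (F : EuclideanSpace ℝ (Fin n) → ℝ) :
    ∑ y ∈ (ofFamily x w hw).carrier, (ofFamily x w hw).weight y * F y = ∑ i, w i * F (x i) := by
  change ∑ y ∈ Finset.univ.image x, (∑ i with x i = y, w i) * F y = _
  rw [← Finset.sum_fiberwise_of_maps_to (g := x) (t := Finset.univ.image x)
    (fun i hi => Finset.mem_image_of_mem _ hi)]
  refine Finset.sum_congr rfl fun y _ => ?_
  rw [Finset.sum_mul]
  refine Finset.sum_congr rfl fun i hi => ?_
  rw [(Finset.mem_filter.1 hi).2]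

theorem card_ofFamily (hx : Function.Injective x) :
    (ofFamily x w hw).carrier.card = Fintype.card ι := by
  change (Finset.univ.image x).card = _
  rw [Finset.card_image_of_injective _ hx, Finset.card_univ]

theorem weight_ofFamily (hx : Function.Injective x) (i : ι) :
    (ofFamily x w hw).weight (x i) = w i := by
  change ∑ j with x j = x i, w j = _
  simp [Finset.sum_filter, hx.eq_iff]

theorem norm_mem_radii_ofFamily (i : ι) : ‖x i‖ ∈ (ofFamily x w hw).radii :=
  Finset.mem_image_of_mem _ (mem_carrier_ofFamily hw i)

theorem mem_support_ofFamily (i : ι) {y : EuclideanSpace ℝ (Fin n)} (hy : ‖y‖ = ‖x i‖) :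
    y ∈ (ofFamily x w hw).support := by
  change ‖y‖ ∈ (ofFamily x w hw).radii
  rw [hy]
  exact norm_mem_radii_ofFamily hw i

/-- Norms are nonnegative, so radii can be counted through their squares; `σ` labels the sphere of
each point. The explicit designs thus need no square roots for their radii. -/
theorem numSpheres_ofFamily {p : ℕ} {ρ : Fin p → ℝ} (hρ : Function.Injective ρ) {σ : ι → Fin p}
    (hσ : Function.Surjective σ) (h : ∀ i, ‖x i‖ ^ 2 = ρ (σ i)) :
    (ofFamily x w hw).numSpheres = p := by
  have e : ((ofFamily x w hw).radii.image fun r => r ^ 2) = Finset.univ.image ρ := by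
    change (((Finset.univ.image x).image fun y => ‖y‖).image fun r => r ^ 2) = _
    ext t
    simp only [Finset.mem_image, Finset.mem_univ, true_and, exists_exists_eq_and, h]
    exact ⟨fun ⟨i, hi⟩ => ⟨σ i, hi⟩, fun ⟨j, hj⟩ => by
      obtain ⟨i, rfl⟩ := hσ j
      exact ⟨i, hj⟩⟩
  have hc := congrArg Finset.card e
  rw [Finset.card_image_of_injective _ hρ, Finset.card_univ, Fintype.card_fin,
    Finset.card_image_of_injOn] at hc
  · exact hc
  · intro a ha b hb hab
    have nonneg : ∀ r ∈ (ofFamily x w hw).radii, 0 ≤ r := by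
      intro r hr
      obtain ⟨y, -, rfl⟩ := Finset.mem_image.1 hr
      exact norm_nonneg y
    exact (sq_eq_sq₀ (nonneg a ha) (nonneg b hb)).1 hab

theorem isTightEuclidean_one (hn : 1 ≤ n) (hx : Function.Injective x)
    (hcard : Fintype.card ι = n + 1) (hD : (ofFamily x w hw).IsEuclideanDesign 2)
    {i : ι} (hi : 0 < ‖x i‖) : (ofFamily x w hw).IsTightEuclidean 1 := by
  have h := finrank_map_polyRestrict (polSpace n 1) (ofFamily x w hw).support fun f hf h0 =>
    eq_zero_of_mem_polSpace_one hn hf hi fun y hy => h0 y (mem_support_ofFamily hw i hy)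
  exact ⟨⟨hD, by rw [card_ofFamily hw hx, h, finrank_polSpace_one, hcard]⟩, h⟩

end

theorem moment_ofFamily {ι : Type*} [Fintype ι] [DecidableEq ι]
    {x : ι → EuclideanSpace ℝ (Fin 2)} {w : ι → ℝ} (hw : ∀ i, 0 < w i) (a b : ℕ) :
    (ofFamily x w hw).moment a b = ∑ i, w i * (x i 0 ^ a * x i 1 ^ b) :=
  sum_ofFamily hw fun y => y 0 ^ a * y 1 ^ b

theorem isTightEuclidean_two {ι : Type*} [Fintype ι] [DecidableEq ι]
    {x : ι → EuclideanSpace ℝ (Fin 2)} {w : ι → ℝ} (hw : ∀ i, 0 < w i)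
    (hx : Function.Injective x) (hcard : Fintype.card ι = 6)
    (hD : (ofFamily x w hw).IsEuclideanDesign 4)
    {i j : ι} (hi : 0 < ‖x i‖) (hj : 0 < ‖x j‖) (hij : ‖x i‖ ≠ ‖x j‖) :
    (ofFamily x w hw).IsTightEuclidean 2 := by
  have h := finrank_map_polyRestrict (polSpace 2 2) (ofFamily x w hw).support fun f hf h0 =>
    eq_zero_of_mem_polSpace_two hf hi hj hij fun y hy =>
      h0 y (hy.elim (mem_support_ofFamily hw i) (mem_support_ofFamily hw j))
  exact ⟨⟨hD, by rw [card_ofFamily hw hx, h, finrank_polSpace_two_two, hcard]⟩, h⟩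

theorem injective_sumElim_neg {n : ℕ} {ι : Type*} {x : ι → EuclideanSpace ℝ (Fin n)}
    (hx : Function.Injective x) (hx' : ∀ i j, x i ≠ -x j) :
    Function.Injective (Sum.elim x fun i => -x i) :=
  hx.sumElim (neg_injective.comp hx) hx'

/-- The antipodal weighted point set generated by a family of points with positive weights. -/
noncomputable def ofHalf {n : ℕ} {ι : Type*} [Fintype ι] [DecidableEq ι]
    (x : ι → EuclideanSpace ℝ (Fin n)) (w : ι → ℝ) (hw : ∀ i, 0 < w i) : WeightedPointSet n :=
  ofFamily (Sum.elim x fun i => -x i) (Sum.elim w w) (Sum.forall.2 ⟨hw, hw⟩)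

section

variable {n : ℕ} {ι : Type*} [Fintype ι] [DecidableEq ι]
  {x : ι → EuclideanSpace ℝ (Fin n)} {w : ι → ℝ} (hw : ∀ i, 0 < w i)

theorem mem_carrier_ofHalf (i : ι) : x i ∈ (ofHalf x w hw).carrier :=
  mem_carrier_ofFamily (x := Sum.elim x fun i => -x i) _ (Sum.inl i)

theorem isAntipodal_ofHalf (hx : Function.Injective x) (hx' : ∀ i j, x i ≠ -x j) :
    (ofHalf x w hw).IsAntipodal := by
  have hinj := injective_sumElim_neg hx hx'
  intro y hy
  obtain ⟨i, -, rfl⟩ := Finset.mem_image.1 hy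
  have e : -(Sum.elim x (fun i => -x i) i) = Sum.elim x (fun i => -x i) i.swap := by
    cases i <;> simp
  rw [e]
  refine ⟨mem_carrier_ofFamily _ _, ?_⟩
  unfold ofHalf
  rw [weight_ofFamily _ hinj, weight_ofFamily _ hinj]
  cases i <;> rfl

theorem isAntipodalHalf_ofHalf (hx' : ∀ i j, x i ≠ -x j) :
    (ofHalf x w hw).IsAntipodalHalf (Finset.univ.image x) := by
  constructor
  · change _ = ((Finset.univ.image (Sum.elim x fun i => -x i) :
      Finset (EuclideanSpace ℝ (Fin n))) : Set (EuclideanSpace ℝ (Fin n)))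
    ext y
    simp [neg_eq_iff_eq_neg]
  · rintro y ⟨hy, hy'⟩
    obtain ⟨i, -, rfl⟩ := Finset.mem_image.1 (Finset.mem_coe.1 hy)
    obtain ⟨j, -, hj⟩ := Finset.mem_image.1 (Finset.mem_coe.1 (Set.mem_neg.1 hy'))
    exact absurd (neg_eq_iff_eq_neg.1 hj.symm) (hx' i j)

theorem numSpheres_ofHalf {p : ℕ} {ρ : Fin p → ℝ} (hρ : Function.Injective ρ) {σ : ι → Fin p}
    (hσ : Function.Surjective σ) (h : ∀ i, ‖x i‖ ^ 2 = ρ (σ i)) :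
    (ofHalf x w hw).numSpheres = p :=
  numSpheres_ofFamily _ hρ (σ := Sum.elim σ σ)
    (fun j => (hσ j).imp' Sum.inl fun _ h => h) (Sum.forall.2 ⟨h, fun i => by simpa using h i⟩)

/-- The vanishing hypothesis is put on the larger space `polSpace n e`, so that the vanishing lemmas
for full polynomial spaces serve here too. -/
theorem isAntipodalTightEuclidean_ofHalf (e : ℕ)
    (hx : Function.Injective x) (hx' : ∀ i j, x i ≠ -x j)
    (hD : (ofHalf x w hw).IsEuclideanDesign (2 * e + 1))
    (hcard : Fintype.card ι = Module.finrank ℝ (polStarSpace n e))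
    (h0 : ∀ f ∈ polSpace n e, (∀ y i, ‖y‖ = ‖x i‖ → polyEval f y = 0) → f = 0) :
    (ofHalf x w hw).IsAntipodalTightEuclidean e := by
  have h := finrank_map_polyRestrict (polStarSpace n e) (ofHalf x w hw).support fun f hf hz =>
    h0 f (polStarSpace_le_polSpace n e hf) fun y i hy =>
      hz y (mem_support_ofFamily (x := Sum.elim x fun i => -x i) _ (Sum.inl i) hy)
  refine ⟨⟨hD, isAntipodal_ofHalf hw hx hx', Finset.univ.image x, isAntipodalHalf_ofHalf hw hx', ?_⟩,
    h⟩
  rw [h, ← hcard, Finset.card_image_of_injective _ hx, Finset.card_univ]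

end

theorem moment_ofHalf_of_even {ι : Type*} [Fintype ι] [DecidableEq ι]
    {x : ι → EuclideanSpace ℝ (Fin 2)} {w : ι → ℝ} (hw : ∀ i, 0 < w i) {a b : ℕ}
    (hab : Even (a + b)) :
    (ofHalf x w hw).moment a b = 2 * ∑ i, w i * (x i 0 ^ a * x i 1 ^ b) := by
  unfold ofHalf
  rw [moment_ofFamily, Fintype.sum_sum_type, two_mul]
  congr 1
  refine Finset.sum_congr rfl fun i _ => ?_
  have e : (-x i 0) ^ a * (-x i 1) ^ b = x i 0 ^ a * x i 1 ^ b := by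
    rw [neg_pow (x i 0), neg_pow (x i 1), mul_mul_mul_comm, ← pow_add, hab.neg_one_pow, one_mul]
  simp only [Sum.elim_inr, PiLp.neg_apply, e]

/-! ### An isomorphism invariant. -/

/-- The finite set of quotients of squared norms of points of a weighted point set. -/
noncomputable def normRatios {n : ℕ} (D : WeightedPointSet n) : Finset ℝ :=
  (D.carrier ×ˢ D.carrier).image fun p => ‖p.1‖ ^ 2 / ‖p.2‖ ^ 2

theorem mem_normRatios {n : ℕ} {D : WeightedPointSet n} {q : ℝ} :
    q ∈ D.normRatios ↔ ∃ x ∈ D.carrier, ∃ y ∈ D.carrier, ‖x‖ ^ 2 / ‖y‖ ^ 2 = q := by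
  simp only [normRatios, Finset.mem_image, Finset.mem_product, Prod.exists]
  exact ⟨fun ⟨x, y, ⟨hx, hy⟩, h⟩ => ⟨x, hx, y, hy, h⟩, fun ⟨x, hx, y, hy, h⟩ => ⟨x, y, ⟨hx, hy⟩, h⟩⟩

/-- The scaling factor cancels in each quotient. A point at the origin does no harm: division by
zero gives zero on both sides. -/
theorem Isomorphic.normRatios_eq {n : ℕ} {D D' : WeightedPointSet n} (h : D.Isomorphic D') :
    D.normRatios = D'.normRatios := by
  obtain ⟨g, c, m, hc, -, hX, -⟩ := h
  have hq : ∀ x y, ‖c • g x‖ ^ 2 / ‖c • g y‖ ^ 2 = ‖x‖ ^ 2 / ‖y‖ ^ 2 := by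
    intro x y
    rw [norm_smul, norm_smul, mul_pow, mul_pow, g.norm_map, g.norm_map,
      mul_div_mul_left _ _ (by simpa using hc.ne')]
  have hsurj : ∀ y ∈ D'.carrier, ∃ x ∈ D.carrier, c • g x = y := by
    intro y hy
    have e : c • g (g.symm (c⁻¹ • y)) = y := by simp [smul_smul, hc.ne']
    exact ⟨_, (hX _).2 (e.symm ▸ hy), e⟩
  ext q
  rw [mem_normRatios, mem_normRatios]
  constructor
  · rintro ⟨x, hx, y, hy, rfl⟩
    exact ⟨_, (hX x).1 hx, _, (hX y).1 hy, hq x y⟩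
  · rintro ⟨x', hx', y', hy', rfl⟩
    obtain ⟨x, hx, rfl⟩ := hsurj x' hx'
    obtain ⟨y, hy, rfl⟩ := hsurj y' hy'
    exact ⟨x, hx, y, hy, (hq x y).symm⟩

end WeightedPointSet

/-- If designs with property `P` realize infinitely many quotients of squared radii, then
infinitely many of them are pairwise non-isomorphic. -/
theorem infinitelyManyNonisomorphic_of_normRatios {n : ℕ} {P : WeightedPointSet n → Prop}
    (ρ : ℕ → ℝ) (hρ : Function.Injective ρ)
    (h : ∀ k, ∃ D : WeightedPointSet n, P D ∧ ρ k ∈ D.normRatios) :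
    InfinitelyManyNonisomorphic P := by
  choose D hP hD using h
  -- Finitely many finite sets of quotients could not contain the infinite range of `ρ`.
  have hinf : (Set.range fun k => (D k).normRatios).Infinite := by
    intro hfin
    refine Set.infinite_range_of_injective hρ ((hfin.biUnion fun s _ => s.finite_toSet).subset ?_)
    rintro _ ⟨k, rfl⟩
    exact Set.mem_biUnion ⟨k, rfl⟩ (hD k)
  choose j hj using fun k => (hinf.natEmbedding _ k).2
  refine ⟨fun k => D (j k), fun k => hP _, fun k l hkl hiso => hkl ?_⟩
  have := hiso.normRatios_eq
  simp only at hj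
  rw [hj, hj] at this
  exact (hinf.natEmbedding _).injective (Subtype.ext this)

/-! ### Planar tight designs from moment identities. -/

namespace WeightedPointSet

section planar

variable {ι : Type*} {u v w : ι → ℝ} {p : ℕ} {ρ : Fin p → ℝ}
  {σ : ι → Fin p}

theorem planar_norm_sq (h : ∀ i, u i ^ 2 + v i ^ 2 = ρ (σ i)) (i : ι) :
    ‖(!₂[u i, v i] : EuclideanSpace ℝ (Fin 2))‖ ^ 2 = ρ (σ i) := by
  rw [euclideanPlane_norm_sq, ← h i]
  rfl

theorem planar_norm_pos (h : ∀ i, u i ^ 2 + v i ^ 2 = ρ (σ i)) (hρ0 : ∀ j, 0 < ρ j) (i : ι) :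
    0 < ‖(!₂[u i, v i] : EuclideanSpace ℝ (Fin 2))‖ := by
  have := planar_norm_sq h i
  have h0 := hρ0 (σ i)
  rw [← this] at h0
  exact lt_of_le_of_ne (norm_nonneg _) fun e => by simp [← e] at h0

theorem planar_injective (hρ : Function.Injective ρ) (h : ∀ i, u i ^ 2 + v i ^ 2 = ρ (σ i))
    (hinj : ∀ i j, σ i = σ j → v i = v j → i = j) :
    Function.Injective fun i => (!₂[u i, v i] : EuclideanSpace ℝ (Fin 2)) := by
  intro i j hij
  refine hinj i j (hρ ?_) (congrArg (fun x : EuclideanSpace ℝ (Fin 2) => x 1) hij)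
  rw [← planar_norm_sq h, ← planar_norm_sq h]
  exact congrArg (fun x : EuclideanSpace ℝ (Fin 2) => ‖x‖ ^ 2) hij

/-- A linear form that is positive at all points separates them from their negatives. -/
theorem planar_ne_neg {α β : ℝ} (hpos : ∀ i, 0 < α * u i + β * v i) (i j : ι) :
    (!₂[u i, v i] : EuclideanSpace ℝ (Fin 2)) ≠ -!₂[u j, v j] := by
  intro e
  have e0 : u i = -u j := congrArg (fun x : EuclideanSpace ℝ (Fin 2) => x 0) e
  have e1 : v i = -v j := congrArg (fun x : EuclideanSpace ℝ (Fin 2) => x 1) e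
  have := hpos i
  have := hpos j
  rw [e0, e1] at *
  linarith

variable [Fintype ι] [DecidableEq ι]

/-- A tight Euclidean 4-design in the plane from six points whose moments satisfy the required
identities. -/
theorem exists_tight_four (hw : ∀ i, 0 < w i) (hcard : Fintype.card ι = 6)
    (hρ : Function.Injective ρ) (hρ0 : ∀ j, 0 < ρ j) (hp : 2 ≤ p)
    (hσ : Function.Surjective σ) (h : ∀ i, u i ^ 2 + v i ^ 2 = ρ (σ i))
    (hinj : ∀ i j, σ i = σ j → v i = v j → i = j)
    (h10 : ∑ i, w i * u i = 0) (h01 : ∑ i, w i * v i = 0)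
    (h11 : ∑ i, w i * (u i * v i) = 0) (h20 : ∑ i, w i * u i ^ 2 = ∑ i, w i * v i ^ 2)
    (h30 : ∑ i, w i * u i ^ 3 = 0) (h21 : ∑ i, w i * (u i ^ 2 * v i) = 0)
    (h12 : ∑ i, w i * (u i * v i ^ 2) = 0) (h03 : ∑ i, w i * v i ^ 3 = 0)
    (h31 : ∑ i, w i * (u i ^ 3 * v i) = 0) (h13 : ∑ i, w i * (u i * v i ^ 3) = 0)
    (h40 : ∑ i, w i * u i ^ 4 = 3 * ∑ i, w i * (u i ^ 2 * v i ^ 2))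
    (h04 : ∑ i, w i * v i ^ 4 = 3 * ∑ i, w i * (u i ^ 2 * v i ^ 2)) (j k : Fin p) :
    ∃ D : WeightedPointSet 2, (D.IsTightEuclidean 2 ∧ D.numSpheres = p) ∧
      ρ j / ρ k ∈ D.normRatios := by
  have hx := planar_injective hρ h hinj
  have hm : ∀ a b, (ofFamily (fun i => !₂[u i, v i]) w hw).moment a b
      = ∑ i, w i * (u i ^ a * v i ^ b) := fun a b => moment_ofFamily hw a b
  refine ⟨ofFamily (fun i => !₂[u i, v i]) w hw, ⟨?_, ?_⟩, ?_⟩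
  · obtain ⟨i, hi⟩ := hσ ⟨0, by omega⟩
    obtain ⟨i', hi'⟩ := hσ ⟨1, by omega⟩
    refine isTightEuclidean_two hw hx hcard ?_ (planar_norm_pos h hρ0 i)
      (planar_norm_pos h hρ0 i') fun e => ?_
    · refine isEuclideanDesign_of_moments _ 4 (by norm_num) ?_ ?_ ?_
      · intro a b hab hle
        rw [hm]
        have : (a = 1 ∧ b = 0) ∨ (a = 0 ∧ b = 1) ∨ (a = 3 ∧ b = 0) ∨ (a = 2 ∧ b = 1) ∨
            (a = 1 ∧ b = 2) ∨ (a = 0 ∧ b = 3) := by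
          obtain ⟨c, hc⟩ := hab
          omega
        rcases this with ⟨rfl, rfl⟩ | ⟨rfl, rfl⟩ | ⟨rfl, rfl⟩ | ⟨rfl, rfl⟩ | ⟨rfl, rfl⟩ |
          ⟨rfl, rfl⟩ <;> simpa only [pow_zero, pow_one, one_mul, mul_one]
      · intro _
        simp only [hm, pow_zero, pow_one, one_mul, mul_one]
        exact ⟨h11, h20⟩
      · intro _
        simp only [hm, pow_zero, pow_one, one_mul, mul_one]
        exact ⟨h31, h13, h40, h04⟩
    · have : ρ (σ i) = ρ (σ i') := by rw [← planar_norm_sq h, ← planar_norm_sq h, e]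
      have := hρ this
      rw [hi, hi'] at this
      simp at this
  · exact numSpheres_ofFamily hw hρ hσ (planar_norm_sq h)
  · obtain ⟨i, rfl⟩ := hσ j
    obtain ⟨i', rfl⟩ := hσ k
    exact mem_normRatios.2 ⟨_, mem_carrier_ofFamily hw i, _, mem_carrier_ofFamily hw i', by
      rw [planar_norm_sq h, planar_norm_sq h]⟩

/-- An antipodal tight Euclidean 3-design in the plane from two points. -/
theorem exists_antipodal_tight_three (hw : ∀ i, 0 < w i) (hcard : Fintype.card ι = 2)
    (hρ : Function.Injective ρ) (hρ0 : ∀ j, 0 < ρ j)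
    (hσ : Function.Surjective σ) (h : ∀ i, u i ^ 2 + v i ^ 2 = ρ (σ i))
    (hinj : ∀ i j, σ i = σ j → v i = v j → i = j)
    {α β : ℝ} (hpos : ∀ i, 0 < α * u i + β * v i)
    (h11 : ∑ i, w i * (u i * v i) = 0) (h20 : ∑ i, w i * u i ^ 2 = ∑ i, w i * v i ^ 2)
    (j k : Fin p) :
    ∃ D : WeightedPointSet 2, (D.IsAntipodalTightEuclidean 1 ∧ D.numSpheres = p) ∧
      ρ j / ρ k ∈ D.normRatios := by
  have hx := planar_injective hρ h hinj
  have hneg := planar_ne_neg hpos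
  have hm : ∀ a b, Even (a + b) → (ofHalf (fun i => !₂[u i, v i]) w hw).moment a b
      = 2 * ∑ i, w i * (u i ^ a * v i ^ b) := fun a b hab => moment_ofHalf_of_even hw hab
  refine ⟨ofHalf (fun i => !₂[u i, v i]) w hw, ⟨?_, ?_⟩, ?_⟩
  · refine isAntipodalTightEuclidean_ofHalf hw 1 hx hneg ?_
      (hcard.trans finrank_polStarSpace_two_one.symm) ?_
    · refine isEuclideanDesign_of_moments _ 3 (by norm_num)
        (fun a b hab _ => (isAntipodal_ofHalf hw hx hneg).moment_eq_zero hab) ?_ (by norm_num)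
      intro _
      rw [hm 1 1 (by decide), hm 2 0 (by decide), hm 0 2 (by decide)]
      simp only [pow_zero, pow_one, one_mul, mul_one]
      rw [h11, h20]
      simp
    · intro f hf hz
      obtain ⟨i, -⟩ := hσ j
      exact eq_zero_of_mem_polSpace_one (by norm_num) hf (planar_norm_pos h hρ0 i)
        fun y hy => hz y i hy
  · exact numSpheres_ofHalf hw hρ hσ (planar_norm_sq h)
  · obtain ⟨i, rfl⟩ := hσ j
    obtain ⟨i', rfl⟩ := hσ k
    exact mem_normRatios.2 ⟨_, mem_carrier_ofHalf hw i, _, mem_carrier_ofHalf hw i', by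
      rw [planar_norm_sq h, planar_norm_sq h]⟩

/-- An antipodal tight Euclidean 5-design in the plane from four points. -/
theorem exists_antipodal_tight_five (hw : ∀ i, 0 < w i) (hcard : Fintype.card ι = 4)
    (hρ : Function.Injective ρ) (hρ0 : ∀ j, 0 < ρ j) (hp : 2 ≤ p)
    (hσ : Function.Surjective σ) (h : ∀ i, u i ^ 2 + v i ^ 2 = ρ (σ i))
    (hinj : ∀ i j, σ i = σ j → v i = v j → i = j)
    {α β : ℝ} (hpos : ∀ i, 0 < α * u i + β * v i)
    (h11 : ∑ i, w i * (u i * v i) = 0) (h20 : ∑ i, w i * u i ^ 2 = ∑ i, w i * v i ^ 2)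
    (h31 : ∑ i, w i * (u i ^ 3 * v i) = 0) (h13 : ∑ i, w i * (u i * v i ^ 3) = 0)
    (h40 : ∑ i, w i * u i ^ 4 = 3 * ∑ i, w i * (u i ^ 2 * v i ^ 2))
    (h04 : ∑ i, w i * v i ^ 4 = 3 * ∑ i, w i * (u i ^ 2 * v i ^ 2)) (j k : Fin p) :
    ∃ D : WeightedPointSet 2, (D.IsAntipodalTightEuclidean 2 ∧ D.numSpheres = p) ∧
      ρ j / ρ k ∈ D.normRatios := by
  have hx := planar_injective hρ h hinj
  have hneg := planar_ne_neg hpos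
  have hm : ∀ a b, Even (a + b) → (ofHalf (fun i => !₂[u i, v i]) w hw).moment a b
      = 2 * ∑ i, w i * (u i ^ a * v i ^ b) := fun a b hab => moment_ofHalf_of_even hw hab
  refine ⟨ofHalf (fun i => !₂[u i, v i]) w hw, ⟨?_, ?_⟩, ?_⟩
  · refine isAntipodalTightEuclidean_ofHalf hw 2 hx hneg ?_
      (hcard.trans finrank_polStarSpace_two_two.symm) ?_
    · refine isEuclideanDesign_of_moments _ 5 (by norm_num)
        (fun a b hab _ => (isAntipodal_ofHalf hw hx hneg).moment_eq_zero hab) ?_ ?_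
      · intro _
        rw [hm 1 1 (by decide), hm 2 0 (by decide), hm 0 2 (by decide)]
        simp only [pow_zero, pow_one, one_mul, mul_one]
        rw [h11, h20]
        simp
      · intro _
        rw [hm 3 1 (by decide), hm 1 3 (by decide), hm 4 0 (by decide), hm 0 4 (by decide),
          hm 2 2 (by decide)]
        simp only [pow_zero, pow_one, one_mul, mul_one]
        rw [h31, h13, h40, h04]
        refine ⟨by simp, by simp, by ring, by ring⟩
    · intro f hf hz
      obtain ⟨i, hi⟩ := hσ ⟨0, by omega⟩
      obtain ⟨i', hi'⟩ := hσ ⟨1, by omega⟩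
      refine eq_zero_of_mem_polSpace_two hf (planar_norm_pos h hρ0 i) (planar_norm_pos h hρ0 i')
        (fun e => ?_) fun y hy => hy.elim (hz y i) (hz y i')
      have : ρ (σ i) = ρ (σ i') := by rw [← planar_norm_sq h, ← planar_norm_sq h, e]
      have := hρ this
      rw [hi, hi'] at this
      simp at this
  · exact numSpheres_ofHalf hw hρ hσ (planar_norm_sq h)
  · obtain ⟨i, rfl⟩ := hσ j
    obtain ⟨i', rfl⟩ := hσ k
    exact mem_normRatios.2 ⟨_, mem_carrier_ofHalf hw i, _, mem_carrier_ofHalf hw i', by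
      rw [planar_norm_sq h, planar_norm_sq h]⟩

end planar

/-! ### Explicit planar families. -/

theorem exists_antipodal_tight_three_two_circles {r : ℝ} (hr : 1 < r) :
    ∃ D : WeightedPointSet 2, (D.IsAntipodalTightEuclidean 1 ∧ D.numSpheres = 2) ∧
      r ^ 2 ∈ D.normRatios := by
  have h := exists_antipodal_tight_three (u := ![1, 0]) (v := ![0, r]) (w := ![1, 1 / r ^ 2])
    (ρ := ![1, r ^ 2]) (σ := id) (α := 1) (β := 1)
    (by simp [Fin.forall_fin_two]; positivity) (by simp)
    (StrictMono.injective (Fin.strictMono_iff_lt_succ.2 (by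
      simp [-one_lt_sq_iff_one_lt_abs, Fin.forall_fin_succ]; nlinarith)))
    (by simp [Fin.forall_fin_two]; positivity) Function.surjective_id
    (by simp [Fin.forall_fin_two]) (fun i j h _ => h) (by simp [Fin.forall_fin_two]; linarith)
    (by simp) (by simp; field_simp) 1 0
  simpa using h

/-- Fix `(√3, ±1)` with weight one and give `(0, 1)`, `(0, m)` weights `A`, `B`. The moment
identities become `A + B m² = 4` and `A + B m⁴ = 16`, whose solution is positive for `m > 2`. At `m
= 2` the weight `A` vanishes and half of a regular hexagon remains. -/
theorem exists_antipodal_tight_five_three_circles {m : ℝ} (hm : 2 < m) :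
    ∃ D : WeightedPointSet 2, (D.IsAntipodalTightEuclidean 2 ∧ D.numSpheres = 3) ∧
      m ^ 2 ∈ D.normRatios := by
  have h3 : √3 ^ 2 = (3 : ℝ) := Real.sq_sqrt (by norm_num)
  have h31 : 1 < √3 := by
    rw [Real.lt_sqrt] <;> norm_num
  have hm1 : 0 < m ^ 2 - 1 := by nlinarith
  have hm4 : 0 < m ^ 2 - 4 := by nlinarith
  have h := exists_antipodal_tight_five (u := ![√3, √3, 0, 0]) (v := ![1, -1, 1, m])
    (w := ![1, 1, 4 * (m ^ 2 - 4) / (m ^ 2 - 1), 12 / (m ^ 2 * (m ^ 2 - 1))])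
    (ρ := ![1, 4, m ^ 2]) (σ := ![1, 1, 0, 2]) (α := 1) (β := 1)
    (by simp [Fin.forall_fin_succ]; constructor <;> positivity) (by simp)
    (StrictMono.injective (Fin.strictMono_iff_lt_succ.2 (by simp [Fin.forall_fin_succ]; linarith)))
    (by simp [Fin.forall_fin_succ]; positivity) (by norm_num) (by decide)
    (by simp [Fin.forall_fin_succ]; norm_num)
    (by simp [Fin.forall_fin_succ]; norm_num)
    (by simp [Fin.forall_fin_succ]; refine ⟨?_, ?_, ?_⟩ <;> linarith)
    (by simp [Fin.sum_univ_succ])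
    (by simp [Fin.sum_univ_succ, h3]; field_simp; ring)
    (by simp [Fin.sum_univ_succ]) (by simp [Fin.sum_univ_succ]; ring)
    (by simp [Fin.sum_univ_succ]; linear_combination (2 * √3 ^ 2 + 6) * h3)
    (by simp [Fin.sum_univ_succ, h3]; field_simp; ring) 2 0
  simpa using h

/-- For a point at `l` times a fixed direction, with weight `c`, the second moments see only `W = c
l²` and the fourth only `V = c l⁴`; `scale` recovers `l` and `c` from them. Along `(2, ±1)` and `(1,
±κ)` with `κ² = 11`, the values `V = 8, 8, 1, 1` solve the quartic identities, and `W = 10 ± κ e, 3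
∓ 2 e` solves the quadratic ones for every `e`. At `e = 0` all points lie on the circle of radius
two; a positive `e` splits it into four. -/
theorem exists_antipodal_tight_five_four_circles {e : ℝ} (he : 0 < e) (he1 : e < 1) :
    ∃ D : WeightedPointSet 2, (D.IsAntipodalTightEuclidean 2 ∧ D.numSpheres = 4) ∧
      (12 / (3 - 2 * e)) / (12 / (3 + 2 * e)) ∈ D.normRatios := by
  obtain ⟨κ, hκ0, hκ⟩ : ∃ κ : ℝ, 0 < κ ∧ κ ^ 2 = 11 :=
    ⟨√11, by positivity, Real.sq_sqrt (by norm_num)⟩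
  have hκ4 : κ < 4 := by nlinarith
  have hκe : κ * e < 4 := by nlinarith
  have hκe0 : 0 < κ * e := by positivity
  have scale : ∀ V W : ℝ, 0 < V → 0 < W → ∃ l c : ℝ, 0 < l ∧ 0 < c ∧ l ^ 2 = V / W ∧
      c * l ^ 2 = W ∧ c * l ^ 4 = V := by
    intro V W hV hW
    have hl : √(V / W) ^ 2 = V / W := Real.sq_sqrt (by positivity)
    refine ⟨√(V / W), W ^ 2 / V, by positivity, by positivity, hl, ?_, ?_⟩
    · rw [hl]; field_simp
    · rw [show √(V / W) ^ 4 = (√(V / W) ^ 2) ^ 2 by ring, hl]; field_simp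
  obtain ⟨l1, c1, hl1, hc1, hn1, hW1, hV1⟩ := scale 8 (10 + κ * e) (by norm_num) (by linarith)
  obtain ⟨l2, c2, hl2, hc2, hn2, hW2, hV2⟩ := scale 8 (10 - κ * e) (by norm_num) (by linarith)
  obtain ⟨l3, c3, hl3, hc3, hn3, hW3, hV3⟩ := scale 1 (3 - 2 * e) (by norm_num) (by linarith)
  obtain ⟨l4, c4, hl4, hc4, hn4, hW4, hV4⟩ := scale 1 (3 + 2 * e) (by norm_num) (by linarith)
  have p1 : 0 < 10 + κ * e := by linarith
  have p2 : 0 < 10 - κ * e := by linarith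
  have p3 : 0 < 3 - 2 * e := by linarith
  have p4 : 0 < 3 + 2 * e := by linarith
  have h := exists_antipodal_tight_five (u := ![2 * l1, 2 * l2, l3, l4])
    (v := ![l1, -l2, κ * l3, -(κ * l4)]) (w := ![c1, c2, c3, c4])
    (ρ := ![12 / (3 + 2 * e), 40 / (10 + κ * e), 40 / (10 - κ * e), 12 / (3 - 2 * e)])
    (σ := ![1, 2, 3, 0]) (α := 1) (β := 0)
    (by simp [Fin.forall_fin_succ, *]) (by simp)
    (StrictMono.injective (Fin.strictMono_iff_lt_succ.2 (by
      simp [Fin.forall_fin_succ]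
      refine ⟨?_, ?_, ?_⟩
      · rw [div_lt_div_iff₀ p4 p1]; nlinarith
      · rw [div_lt_div_iff₀ p1 p2]; nlinarith
      · rw [div_lt_div_iff₀ p2 p3]; nlinarith)))
    (by simp [Fin.forall_fin_succ]; refine ⟨?_, ?_, ?_, ?_⟩ <;> linarith)
    (by norm_num) (by decide)
    (by
      simp [Fin.forall_fin_succ, mul_pow, hn1, hn2, hn3, hn4, hκ]
      refine ⟨?_, ?_, ?_, ?_⟩ <;> field_simp <;> norm_num)
    (by simp [Fin.forall_fin_succ])
    (by simp [Fin.forall_fin_succ, *])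
    (by
      simp [Fin.sum_univ_succ]
      linear_combination 2 * hW1 - 2 * hW2 + κ * hW3 - κ * hW4)
    (by
      simp [Fin.sum_univ_succ]
      linear_combination 3 * hW1 + 3 * hW2 + (1 - κ ^ 2) * hW3 + (1 - κ ^ 2) * hW4 - 6 * hκ)
    (by
      simp [Fin.sum_univ_succ]
      linear_combination 8 * hV1 - 8 * hV2 + κ * hV3 - κ * hV4)
    (by
      simp [Fin.sum_univ_succ]
      linear_combination 2 * hV1 - 2 * hV2 + κ ^ 3 * hV3 - κ ^ 3 * hV4)
    (by
      simp [Fin.sum_univ_succ]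
      linear_combination 4 * hV1 + 4 * hV2 + (1 - 3 * κ ^ 2) * hV3 + (1 - 3 * κ ^ 2) * hV4
        - 6 * hκ)
    (by
      simp [Fin.sum_univ_succ]
      linear_combination (-11) * hV1 - 11 * hV2 + (κ ^ 4 - 3 * κ ^ 2) * hV3
        + (κ ^ 4 - 3 * κ ^ 2) * hV4 + 2 * (κ ^ 2 + 8) * hκ) 3 0
  simpa using h

/-- A deformation, symmetric in the first axis, of two opposite equilateral triangles of radii `1`
and `2`, which occur at `τ = 1 / 2`. Symmetry kills the moments odd in `v`. With unit weights on the
inner triangle, the moment of `u v²` fixes the weight of the outer pair, and then the moment of `u`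
fixes that of the remaining point. -/
theorem exists_tight_four_three_circles {τ : ℝ} (h0 : 0 < τ) (h1 : τ < 1 / 2) :
    ∃ D : WeightedPointSet 2, (D.IsTightEuclidean 2 ∧ D.numSpheres = 3) ∧
      (1 + 2 * τ) ^ 2 ∈ D.normRatios := by
  have p1 : 0 < 1 - τ := by linarith
  have p2 : 0 < 1 + 2 * τ := by linarith
  have p3 : 0 < 1 + 2 * τ - 4 * τ ^ 2 := by nlinarith
  obtain ⟨q, hq0, hq⟩ : ∃ q : ℝ, 0 < q ∧ q ^ 2 = 1 - τ ^ 2 :=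
    ⟨√(1 - τ ^ 2), Real.sqrt_pos.2 (by nlinarith), Real.sq_sqrt (by nlinarith)⟩
  have hq4 : q ^ 4 = (1 - τ ^ 2) ^ 2 := by rw [← hq]; ring
  obtain ⟨Y, hY0, hY, hY4⟩ : ∃ Y : ℝ, 0 < Y ∧
      Y ^ 2 = (1 + 2 * τ) ^ 2 * (1 - τ ^ 2) / (4 * τ ^ 2) ∧
      Y ^ 4 = ((1 + 2 * τ) ^ 2 * (1 - τ ^ 2) / (4 * τ ^ 2)) ^ 2 := by
    have e : ((1 + 2 * τ) * q / (2 * τ)) ^ 2 = (1 + 2 * τ) ^ 2 * (1 - τ ^ 2) / (4 * τ ^ 2) := by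
      rw [← hq]; field_simp; norm_num
    exact ⟨(1 + 2 * τ) * q / (2 * τ), by positivity, e, by rw [← e]; ring⟩
  have h := exists_tight_four
    (u := ![1, -τ, -τ, -(1 + 2 * τ), (1 + 2 * τ) * (1 - τ) / (2 * τ),
      (1 + 2 * τ) * (1 - τ) / (2 * τ)])
    (v := ![0, q, -q, 0, Y, -Y])
    (w := ![1, 1, 1, (1 + 2 * τ - 4 * τ ^ 2) / (1 + 2 * τ) ^ 3,
      8 * τ ^ 4 / ((1 + 2 * τ) ^ 3 * (1 - τ)), 8 * τ ^ 4 / ((1 + 2 * τ) ^ 3 * (1 - τ))])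
    (ρ := ![1, (1 + 2 * τ) ^ 2, (1 + 2 * τ) ^ 2 * ((1 - τ) / (2 * τ ^ 2))])
    (σ := ![0, 0, 0, 1, 2, 2])
    (by simp [Fin.forall_fin_succ]; constructor <;> positivity) (by simp)
    (StrictMono.injective (Fin.strictMono_iff_lt_succ.2 (by
      simp [-one_lt_sq_iff_one_lt_abs, Fin.forall_fin_succ]
      refine ⟨by nlinarith, ?_⟩
      refine lt_mul_of_one_lt_right (by positivity) ?_
      rw [one_lt_div (by positivity)]
      nlinarith)))
    (by simp [Fin.forall_fin_succ]; constructor <;> positivity)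
    (by norm_num) (by decide)
    (by
      simp [Fin.forall_fin_succ, hq, hY]
      field_simp
      ring_nf
      simp)
    (by
      have a1 : q ≠ -q := by linarith
      have a2 : Y ≠ -Y := by linarith
      simp [Fin.forall_fin_succ, hq0.ne, hq0.ne', a1, a1.symm, a2, a2.symm])
    (by simp [Fin.sum_univ_succ]; field_simp; ring)
    (by simp [Fin.sum_univ_succ])
    (by simp [Fin.sum_univ_succ])
    (by simp [Fin.sum_univ_succ, hq, hY]; field_simp; ring)
    (by simp [Fin.sum_univ_succ]; field_simp; ring)
    (by simp [Fin.sum_univ_succ])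
    (by simp [Fin.sum_univ_succ, hq, hY]; field_simp; ring)
    (by simp [Fin.sum_univ_succ]; ring)
    (by simp [Fin.sum_univ_succ])
    (by simp [Fin.sum_univ_succ]; ring)
    (by simp [Fin.sum_univ_succ, hq, hY]; field_simp; ring)
    (by
      have e1 : (-q) ^ 4 = (1 - τ ^ 2) ^ 2 := by rw [← hq4]; ring
      have e2 : (-Y) ^ 4 = ((1 + 2 * τ) ^ 2 * (1 - τ ^ 2) / (4 * τ ^ 2)) ^ 2 := by
        rw [← hY4]; ring
      simp [Fin.sum_univ_succ, hq, hY, hq4, hY4, e1, e2]; field_simp; ring) 1 0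
  simpa using h

/-- A deformation, symmetric in the first axis, of the regular hexagon of radius two, which is the
case `y = 0`. The pairs on `u = ∓1` have squared heights `3 ± y`, with sum `6` as the moment of `v⁴`
demands. What remains is to find two weighted points `a`, `-b` on the axis with four prescribed
power moments. -/
theorem exists_tight_four_four_circles {y : ℝ} (hy0 : 0 < y) (hy1 : y < 1) :
    ∃ D : WeightedPointSet 2, (D.IsTightEuclidean 2 ∧ D.numSpheres = 4) ∧
      (4 + y) / (4 - y) ∈ D.normRatios := by
  have hP : 0 < 4 - y ^ 2 := by nlinarith
  have hN : 0 < 9 - y ^ 2 := by nlinarith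
  have h3p : 0 < 3 + y := by linarith
  have h3m : 0 < 3 - y := by linarith
  -- A quarter of the discriminant of `(4 - y²) t² = 2 y t + (16 - 3 y²)`, whose roots are `a` and
  -- `-b`. This quadratic is the two-term recurrence that the prescribed moments satisfy.
  obtain ⟨Δ, hΔ0, hΔ⟩ : ∃ Δ : ℝ, 0 ≤ Δ ∧ Δ ^ 2 = 3 * y ^ 4 - 27 * y ^ 2 + 64 :=
    ⟨√(3 * y ^ 4 - 27 * y ^ 2 + 64), Real.sqrt_nonneg _, Real.sq_sqrt (by nlinarith [sq_nonneg (y ^ 2)])⟩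
  have hΔy : y < Δ := by nlinarith [sq_nonneg (y ^ 2)]
  obtain ⟨a, ha0, ha⟩ : ∃ a : ℝ, 0 < a ∧ (4 - y ^ 2) * a ^ 2 = 2 * y * a + (16 - 3 * y ^ 2) := by
    refine ⟨(y + Δ) / (4 - y ^ 2), by positivity, ?_⟩
    field_simp
    linear_combination hΔ
  obtain ⟨b, hb0, hb⟩ : ∃ b : ℝ, 0 < b ∧
      (4 - y ^ 2) * b ^ 2 = -(2 * y * b) + (16 - 3 * y ^ 2) := by
    refine ⟨(Δ - y) / (4 - y ^ 2), div_pos (by linarith) hP, ?_⟩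
    field_simp
    linear_combination hΔ
  -- At `2` the quadratic of `a` is negative and that of `b` is positive, hence `b < 2 < a`.
  have ha2 : 2 < a := by
    by_contra! h
    have h1 : 0 < (4 - y ^ 2) * (a + 2) - 2 * y := by nlinarith
    nlinarith [mul_nonneg (sub_nonneg.2 h) h1.le]
  have hb2 : b < 2 := by
    by_contra! h
    have h1 : 0 < (4 - y ^ 2) * (b + 2) + 2 * y := by positivity
    nlinarith [mul_nonneg (sub_nonneg.2 h) h1.le]
  have hasq : 4 + y < a ^ 2 := by
    have : 0 < (4 - y ^ 2) * (a ^ 2 - (4 + y)) := by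
      have : 0 < y * (2 * a - 4 + y + y ^ 2) := by
        apply mul_pos hy0; nlinarith
      nlinarith
    linarith [(pos_iff_pos_of_mul_pos this).1 hP]
  have hbsq : 4 - y < b ^ 2 := by
    have : 0 < (4 - y ^ 2) * (b ^ 2 - (4 - y)) := by
      have : 0 < y * (4 + y - y ^ 2 - 2 * b) := by
        apply mul_pos hy0; nlinarith
      nlinarith
    linarith [(pos_iff_pos_of_mul_pos this).1 hP]
  -- `A` and `B` solve the linear equations for the first two moments; the recurrence then yields
  -- the third and fourth.
  obtain ⟨A, hA0, B, hB0, hm1, hm2⟩ : ∃ A : ℝ, 0 < A ∧ ∃ B : ℝ, 0 < B ∧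
      A * a - B * b = -(2 * y) / (9 - y ^ 2) ∧
      A * a ^ 2 + B * b ^ 2 = (12 - 2 * y ^ 2) / (9 - y ^ 2) := by
    refine ⟨(12 - 2 * y ^ 2 - 2 * y * b) / ((9 - y ^ 2) * a * (a + b)),
      div_pos (by nlinarith) (by positivity),
      (12 - 2 * y ^ 2 + 2 * y * a) / ((9 - y ^ 2) * b * (a + b)),
      div_pos (by nlinarith) (by positivity), ?_, ?_⟩
    · field_simp; ring
    · field_simp; ring
  have hm3 : A * a ^ 3 - B * b ^ 3 = -(2 * y) / (9 - y ^ 2) := by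
    have e : (4 - y ^ 2) * (A * a ^ 3 - B * b ^ 3) = 2 * y * ((12 - 2 * y ^ 2) / (9 - y ^ 2)) +
        (16 - 3 * y ^ 2) * (-(2 * y) / (9 - y ^ 2)) := by
      rw [← hm1, ← hm2]
      linear_combination A * a * ha - B * b * hb
    apply mul_left_cancel₀ hP.ne'
    rw [e]
    field_simp
    ring
  have hm4 : A * a ^ 4 + B * b ^ 4 = (48 - 6 * y ^ 2) / (9 - y ^ 2) := by
    have e : (4 - y ^ 2) * (A * a ^ 4 + B * b ^ 4) = 2 * y * (-(2 * y) / (9 - y ^ 2)) +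
        (16 - 3 * y ^ 2) * ((12 - 2 * y ^ 2) / (9 - y ^ 2)) := by
      rw [← hm3, ← hm2]
      linear_combination A * a ^ 2 * ha + B * b ^ 2 * hb
    apply mul_left_cancel₀ hP.ne'
    rw [e]
    field_simp
    ring
  obtain ⟨u, hu0, hu⟩ : ∃ u : ℝ, 0 < u ∧ u ^ 2 = 3 + y :=
    ⟨√(3 + y), Real.sqrt_pos.2 h3p, Real.sq_sqrt h3p.le⟩
  obtain ⟨v, hv0, hv⟩ : ∃ v : ℝ, 0 < v ∧ v ^ 2 = 3 - y :=
    ⟨√(3 - y), Real.sqrt_pos.2 h3m, Real.sq_sqrt h3m.le⟩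
  obtain ⟨c, hc0, hc⟩ : ∃ c : ℝ, 0 < c ∧ c = (3 - y) / (2 * (9 - y ^ 2)) :=
    ⟨_, by positivity, rfl⟩
  obtain ⟨d, hd0, hd⟩ : ∃ d : ℝ, 0 < d ∧ d = (3 + y) / (2 * (9 - y ^ 2)) :=
    ⟨_, by positivity, rfl⟩
  have hcu : c * u ^ 2 = 1 / 2 := by rw [hc, hu]; field_simp; ring
  have hdv : d * v ^ 2 = 1 / 2 := by rw [hd, hv]; field_simp; ring
  have hcu4 : c * u ^ 4 = (3 + y) / 2 := by linear_combination u ^ 2 * hcu + hu / 2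
  have hdv4 : d * v ^ 4 = (3 - y) / 2 := by linear_combination v ^ 2 * hdv + hv / 2
  have e1 : -(2 * y) / (9 - y ^ 2) = 2 * c - 2 * d := by rw [hc, hd]; field_simp; ring
  have e2 : (12 - 2 * y ^ 2) / (9 - y ^ 2) = 2 - 2 * c - 2 * d := by
    rw [hc, hd]; field_simp; ring
  have e4 : (48 - 6 * y ^ 2) / (9 - y ^ 2) = 6 - 2 * c - 2 * d := by
    rw [hc, hd]; field_simp; ring
  rw [e1] at hm1 hm3
  rw [e2] at hm2
  rw [e4] at hm4
  have h := exists_tight_four (u := ![a, -b, -1, -1, 1, 1]) (v := ![0, 0, u, -u, v, -v])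
    (w := ![A, B, c, c, d, d]) (ρ := ![4 - y, b ^ 2, 4 + y, a ^ 2]) (σ := ![3, 1, 2, 2, 0, 0])
    (by simp [Fin.forall_fin_succ, *]) (by simp)
    (StrictMono.injective (Fin.strictMono_iff_lt_succ.2 (by
      simp only [Fin.forall_fin_succ]
      simp
      exact ⟨hbsq, by nlinarith, hasq⟩)))
    (by simp [Fin.forall_fin_succ]; refine ⟨?_, ?_, ?_, ?_⟩ <;> first | positivity | linarith)
    (by norm_num) (by decide)
    (by
      simp [Fin.forall_fin_succ, hu, hv]
      constructor <;> ring)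
    (by
      have a1 : u ≠ -u := by linarith
      have a2 : v ≠ -v := by linarith
      simp [Fin.forall_fin_succ, a1, a1.symm, a2, a2.symm])
    (by simp [Fin.sum_univ_succ]; linear_combination hm1)
    (by simp [Fin.sum_univ_succ])
    (by simp [Fin.sum_univ_succ])
    (by simp [Fin.sum_univ_succ]; linear_combination hm2 - 2 * hcu - 2 * hdv)
    (by simp [Fin.sum_univ_succ]; linear_combination hm3)
    (by simp [Fin.sum_univ_succ])
    (by simp [Fin.sum_univ_succ]; linear_combination (-2) * hcu + 2 * hdv)
    (by simp [Fin.sum_univ_succ]; ring)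
    (by simp [Fin.sum_univ_succ])
    (by simp [Fin.sum_univ_succ]; ring)
    (by simp [Fin.sum_univ_succ]; linear_combination hm4 - 6 * hcu - 6 * hdv)
    (by
      simp [Fin.sum_univ_succ]
      linear_combination 2 * hcu4 + 2 * hdv4 - 6 * hcu - 6 * hdv) 2 0
  simpa using h

/-! ### Tight 2-designs from orthogonal matrices. -/

/-- Positive weights that sum to one are the weights of a tight Euclidean 2-design, whose points are
read off from an orthogonal matrix with first column `√w`. -/
theorem exists_tight_two {n p : ℕ} (hn : 1 ≤ n) (w : Fin (n + 1) → ℝ) (hw : ∀ k, 0 < w k)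
    (hsum : ∑ k, w k = 1) {c : Fin p → ℝ} (hc : Function.Injective c) {σ : Fin (n + 1) → Fin p}
    (hσ : Function.Surjective σ) (h : ∀ k, w k = c (σ k)) (k l : Fin (n + 1)) :
    ∃ D : WeightedPointSet n, (D.IsTightEuclidean 1 ∧ D.numSpheres = p) ∧
      (1 / w k - 1) / (1 / w l - 1) ∈ D.normRatios := by
  obtain ⟨b, hb⟩ : ∃ b : OrthonormalBasis (Fin (n + 1)) ℝ (EuclideanSpace ℝ (Fin (n + 1))),
      b 0 = WithLp.toLp 2 fun k => √(w k) := by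
    have h1 : ‖(WithLp.toLp 2 fun k => √(w k) : EuclideanSpace ℝ (Fin (n + 1)))‖ = 1 := by
      rw [EuclideanSpace.norm_eq, Real.sqrt_eq_one, ← hsum]
      exact Finset.sum_congr rfl fun k _ => by
        rw [Real.norm_eq_abs, sq_abs, Real.sq_sqrt (hw k).le]
    have hv : Orthonormal ℝ (({(0 : Fin (n + 1))} : Set (Fin (n + 1))).domRestrict
        fun _ => (WithLp.toLp 2 fun k => √(w k) : EuclideanSpace ℝ (Fin (n + 1)))) :=
      ⟨fun _ => h1, fun i j hij => absurd (Subsingleton.elim i j) hij⟩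
    obtain ⟨b, hb⟩ := hv.exists_orthonormalBasis_extension_of_card_eq (by simp)
    exact ⟨b, hb 0 rfl⟩
  have hsq : ∀ k, √(w k) ^ 2 = w k := fun k => Real.sq_sqrt (hw k).le
  have hs0 : ∀ k, 0 < √(w k) := fun k => Real.sqrt_pos.2 (hw k)
  have hrow : ∀ i j, ∑ k, b i k * b j k = if i = j then 1 else 0 := by
    intro i j
    have := orthonormal_iff_ite.1 b.orthonormal j i
    rw [PiLp.inner_apply] at this
    simpa [eq_comm] using this
  -- The columns of the orthogonal matrix are orthonormal too; moving the entries of the first row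
  -- `√w` to the right leaves the Gram matrix of the unscaled points.
  have hcol : ∀ k l, ∑ i : Fin n, b i.succ k * b i.succ l
      = (if k = l then 1 else 0) - √(w k) * √(w l) := by
    intro k l
    have := b.sum_inner_mul_inner (EuclideanSpace.single k (1 : ℝ)) (EuclideanSpace.single l (1 : ℝ))
    rw [Fin.sum_univ_succ, hb] at this
    simp only [EuclideanSpace.inner_single_left, EuclideanSpace.inner_single_right] at this
    simp [eq_comm] at this
    rw [this]
    ring
  let x : Fin (n + 1) → EuclideanSpace ℝ (Fin n) := fun k =>
    WithLp.toLp 2 fun i => b i.succ k / √(w k)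
  have hx : ∀ k i, x k i = b i.succ k / √(w k) := fun k i => rfl
  have hinner : ∀ k l, ∑ i, x k i * x l i = (if k = l then 1 / w k else 0) - 1 := by
    intro k l
    have e : ∑ i, x k i * x l i = (∑ i : Fin n, b i.succ k * b i.succ l) / (√(w k) * √(w l)) := by
      rw [Finset.sum_div]
      exact Finset.sum_congr rfl fun i _ => by rw [hx, hx, div_mul_div_comm]
    rw [e, hcol, sub_div, div_self (mul_pos (hs0 k) (hs0 l)).ne']
    split_ifs with hkl
    · rw [← hkl, ← sq, hsq]
    · simp
  have hnorm : ∀ k, ‖x k‖ ^ 2 = 1 / w k - 1 := by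
    intro k
    rw [EuclideanSpace.norm_sq_eq]
    simpa [sq] using hinner k k
  have hpos : ∀ k, 0 < ‖x k‖ ^ 2 := by
    intro k
    have : w k < 1 := by
      obtain ⟨j, hj⟩ : ∃ j, j ≠ k := by
        have : Nontrivial (Fin (n + 1)) := Fin.nontrivial_iff_two_le.2 (by omega)
        exact exists_ne k
      rw [← hsum, ← Finset.add_sum_erase _ _ (Finset.mem_univ k)]
      have : 0 < ∑ i ∈ Finset.univ.erase k, w i :=
        Finset.sum_pos (fun i _ => hw i) ⟨j, by simp [hj]⟩
      linarith
    rw [hnorm, sub_pos, lt_div_iff₀ (hw k)]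
    linarith
  -- Distinct indices have inner product `-1`, which cannot be a squared norm.
  have hinj : Function.Injective x := by
    intro k l hkl
    by_contra hne
    have h1 := hinner k l
    have h2 := hinner k k
    have h3 := hnorm k
    have h4 := hpos k
    rw [← hkl, if_neg hne] at h1
    rw [if_pos rfl] at h2
    linarith
  refine ⟨ofFamily x w hw, ⟨isTightEuclidean_one hw hn hinj (by simp) ?_ (i := 0) ?_, ?_⟩, ?_⟩
  · refine isEuclideanDesign_two hn _ 1 (fun i => ?_) fun i j => ?_
    · rw [sum_ofFamily hw fun y => y i]
      have := hrow i.succ 0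
      rw [if_neg (Fin.succ_ne_zero i), hb] at this
      rw [← this]
      refine Finset.sum_congr rfl fun k _ => ?_
      rw [hx]
      have := (hs0 k).ne'
      nth_rewrite 1 [← hsq k]
      field_simp
    · rw [sum_ofFamily hw fun y => y i * y j]
      have := hrow i.succ j.succ
      simp only [Fin.succ_inj] at this
      rw [← this]
      refine Finset.sum_congr rfl fun k _ => ?_
      rw [hx, hx]
      have := (hs0 k).ne'
      nth_rewrite 1 [← hsq k]
      field_simp
  · exact lt_of_le_of_ne (norm_nonneg _) fun e => by simpa [← e] using hpos 0
  · refine numSpheres_ofFamily hw (ρ := fun j => 1 / c j - 1) (fun i j hij => hc ?_) hσ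
      fun k => by rw [hnorm, h]
    simpa using hij
  · exact mem_normRatios.2 ⟨_, mem_carrier_ofFamily hw k, _, mem_carrier_ofFamily hw l, by
      rw [hnorm, hnorm]⟩

theorem infinitelyMany_tight_two {n p : ℕ} (hn : 2 ≤ n) (hp : 2 ≤ p) (hpn : p ≤ n + 1) :
    InfinitelyManyNonisomorphic
      (fun D : WeightedPointSet n => D.IsTightEuclidean 1 ∧ D.numSpheres = p) := by
  -- Only index `0` gets label `0`, and all indices from `p - 1` on share the last label.
  let σ : Fin (n + 1) → Fin p := fun k => ⟨min k (p - 1), by omega⟩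
  have hσ : Function.Surjective σ := by
    rintro ⟨j, hj⟩
    exact ⟨⟨j, by omega⟩, Fin.ext (by simp [σ]; omega)⟩
  -- Unnormalized weights: the free parameter `t ≥ p` exceeds the others, which are the labels `1,
  -- …, p - 1`.
  let c : ℝ → Fin p → ℝ := fun t j => if (j : ℕ) = 0 then t else (j : ℕ)
  have hc1 : ∀ t j, 1 ≤ t → 1 ≤ c t j := by
    intro t j ht
    by_cases hj : (j : ℕ) = 0
    · simpa [c, hj] using ht
    · have : (1 : ℝ) ≤ (j : ℕ) := by exact_mod_cast Nat.one_le_iff_ne_zero.2 hj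
      simpa only [c, if_neg hj] using this
  have hcinj : ∀ t : ℝ, (p : ℝ) ≤ t → Function.Injective (c t) := by
    intro t ht i j hij
    have hi : ((i : ℕ) : ℝ) < t := lt_of_lt_of_le (by exact_mod_cast i.2) ht
    have hj : ((j : ℕ) : ℝ) < t := lt_of_lt_of_le (by exact_mod_cast j.2) ht
    simp only [c] at hij
    apply Fin.ext
    split_ifs at hij with h1 h2 h2
    · rw [h1, h2]
    · exact absurd hij hj.ne'
    · exact absurd hij hi.ne
    · exact_mod_cast hij
  have hσ0 : ∀ k : Fin n, ((σ k.succ : Fin p) : ℕ) ≠ 0 := by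
    intro k
    simp [σ]
    omega
  let R : ℝ := ∑ k : Fin n, ((σ k.succ : Fin p) : ℕ)
  have hR : 2 ≤ R := by
    have h1 : ∑ _k : Fin n, (1 : ℝ) ≤ R := Finset.sum_le_sum fun k _ => by
      exact_mod_cast Nat.one_le_iff_ne_zero.2 (hσ0 k)
    have h2 : (2 : ℝ) ≤ n := by exact_mod_cast hn
    simp at h1
    linarith
  have hsum : ∀ t, ∑ k, c t (σ k) = t + R := by
    intro t
    rw [Fin.sum_univ_succ]
    congr 1
    exact Finset.sum_congr rfl fun k _ => if_neg (hσ0 k)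
  -- With `t = p + k` and total `t + R`, this is the quotient of the squared radii of points `0` and
  -- `1`. It is injective in `k` because `R` does not depend on `k`.
  refine infinitelyManyNonisomorphic_of_normRatios
    (fun k => R / ((p + k) * (p + k + R - 1))) (fun k l hkl => ?_) fun k => ?_
  · have hp0 : (2 : ℝ) ≤ p := by exact_mod_cast hp
    have hk : (0 : ℝ) ≤ k := k.cast_nonneg
    have hl : (0 : ℝ) ≤ l := l.cast_nonneg
    have k1 : 0 < (p + k : ℝ) * (p + k + R - 1) := mul_pos (by linarith) (by linarith)
    have l1 : 0 < (p + l : ℝ) * (p + l + R - 1) := mul_pos (by linarith) (by linarith)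
    have e : (p + k : ℝ) * (p + k + R - 1) = (p + l) * (p + l + R - 1) := by
      simp only at hkl
      rw [div_eq_div_iff k1.ne' l1.ne'] at hkl
      exact (mul_left_cancel₀ (by linarith) hkl).symm
    have e' : ((k : ℝ) - l) * (2 * p + k + l + R - 1) = 0 := by linear_combination e
    have := (mul_eq_zero.1 e').resolve_right (by linarith)
    exact_mod_cast sub_eq_zero.1 this
  · have hp0 : (2 : ℝ) ≤ p := by exact_mod_cast hp
    have hk : (0 : ℝ) ≤ k := k.cast_nonneg
    have hS : 0 < (p + k + R : ℝ) := by linarith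
    have h := exists_tight_two (n := n) (p := p) (by omega)
      (fun i => c (p + k) (σ i) / (p + k + R))
      (fun i => div_pos (by linarith [hc1 (p + k) (σ i) (by linarith)]) hS)
      (by rw [← Finset.sum_div, hsum, div_self hS.ne'])
      (c := fun j => c (p + k) j / (p + k + R))
      (fun i j hij => hcinj (p + k) (by linarith) ((div_left_inj' hS.ne').1 hij)) hσ
      (fun i => rfl) 0 ⟨1, by omega⟩
    have c0 : c (p + k) (σ 0) = p + k := by simp [c, σ]
    have c1 : c (p + k) (σ ⟨1, by omega⟩) = 1 := by
      have : min 1 (p - 1) = 1 := by omega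
      simp [c, σ, this]
    simp only [c0, c1] at h
    have e : (1 / ((p + k : ℝ) / (p + k + R)) - 1) / (1 / (1 / (p + k + R : ℝ)) - 1)
        = R / ((p + k) * (p + k + R - 1)) := by
      have h1 : (p + k : ℝ) ≠ 0 := by linarith
      have h2 : (p + k + R - 1 : ℝ) ≠ 0 := by linarith
      rw [one_div_one_div, one_div_div, div_sub_one h1, div_div]
      congr 1
      ring
    rwa [e] at h

end WeightedPointSet

/-! ### Assembly of the four cases. -/

theorem corollary3p9 :
    (∀ n : ℕ, 2 ≤ n → ∀ p : ℕ, 2 ≤ p → p ≤ n + 1 →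
      InfinitelyManyNonisomorphic
        (fun D : WeightedPointSet n => D.IsTightEuclidean 1 ∧ D.numSpheres = p)) ∧
    InfinitelyManyNonisomorphic
      (fun D : WeightedPointSet 2 => D.IsAntipodalTightEuclidean 1 ∧ D.numSpheres = 2) ∧
    (∀ p : ℕ, p = 3 ∨ p = 4 →
      InfinitelyManyNonisomorphic
        (fun D : WeightedPointSet 2 => D.IsTightEuclidean 2 ∧ D.numSpheres = p)) ∧
    (∀ p : ℕ, p = 3 ∨ p = 4 →
      InfinitelyManyNonisomorphic
        (fun D : WeightedPointSet 2 => D.IsAntipodalTightEuclidean 2 ∧ D.numSpheres = p)) := by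
  -- The parameter `1 / (k + 3)` lies in the admissible interval of all three deformations, and `k +
  -- 3` suits the two families with an unbounded radius.
  have hinv : ∀ k : ℕ, (0 : ℝ) < 1 / (k + 3) ∧ (1 : ℝ) / (k + 3) < 1 / 2 := by
    intro k
    have hk : (0 : ℝ) ≤ k := k.cast_nonneg
    exact ⟨by positivity, one_div_lt_one_div_of_lt (by norm_num) (by linarith)⟩
  have hinj : ∀ k l : ℕ, (1 : ℝ) / (k + 3) = 1 / (l + 3) → k = l := by
    intro k l h
    simpa using h
  have hsq : Function.Injective fun k : ℕ => ((k : ℝ) + 3) ^ 2 := by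
    intro k l h
    have := (sq_eq_sq₀ (by positivity) (by positivity)).1 h
    simpa using this
  refine ⟨fun n hn p hp hpn => WeightedPointSet.infinitelyMany_tight_two hn hp hpn, ?_, ?_, ?_⟩
  · exact infinitelyManyNonisomorphic_of_normRatios _ hsq fun k =>
      WeightedPointSet.exists_antipodal_tight_three_two_circles (by linarith [k.cast_nonneg (α := ℝ)])
  · rintro p (rfl | rfl)
    · refine infinitelyManyNonisomorphic_of_normRatios
        (fun k : ℕ => (1 + 2 * (1 / ((k : ℝ) + 3))) ^ 2) (fun k l h => hinj k l ?_) fun k =>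
        WeightedPointSet.exists_tight_four_three_circles (hinv k).1 (hinv k).2
      have := (sq_eq_sq₀ (by positivity) (by positivity)).1 h
      linarith
    · refine infinitelyManyNonisomorphic_of_normRatios
        (fun k : ℕ => (4 + 1 / ((k : ℝ) + 3)) / (4 - 1 / ((k : ℝ) + 3)))
        (fun k l h => hinj k l ?_) fun k =>
        WeightedPointSet.exists_tight_four_four_circles (hinv k).1 (by linarith [(hinv k).2])
      have h1 := (hinv k).2
      have h2 := (hinv l).2
      simp only at h
      rw [div_eq_div_iff (by linarith) (by linarith)] at h
      linarith
  · rintro p (rfl | rfl)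
    · exact infinitelyManyNonisomorphic_of_normRatios _ hsq fun k =>
        WeightedPointSet.exists_antipodal_tight_five_three_circles (by linarith [k.cast_nonneg (α := ℝ)])
    · refine infinitelyManyNonisomorphic_of_normRatios
        (fun k : ℕ => (12 / (3 - 2 * (1 / ((k : ℝ) + 3)))) / (12 / (3 + 2 * (1 / ((k : ℝ) + 3)))))
        (fun k l h => hinj k l ?_) fun k =>
        WeightedPointSet.exists_antipodal_tight_five_four_circles (hinv k).1 (by linarith [(hinv k).2])
      have h1 := hinv k
      have h2 := hinv l
      simp only [div_div_div_eq] at h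
      rw [div_eq_div_iff (by nlinarith) (by nlinarith)] at h
      linarith
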